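/- Let $\mathcal G$ be a connected compact metric graph: finitely many vertices and finitely many edges $e$, each identified with an interval $[0,l_e]$, $l_e>0$ (loops and multiple edges allowed; a loop counts twice in the degree). Let $p>1$, let $v_1$ be a vertex of degree $1$, and let $I_1=[0,l_1]$ be the edge ending at $v_1$, with $v_1$ corresponding to the coordinate $0$. A function on $\mathcal G$ is a family $u=(u_e)_e$ with $u_e:[0,l_e]\to\mathbb R$, and $H^1(\mathcal G)$ is the set of functions that are continuous on $\mathcal G$ with $u_e\in H^1(0,l_e)$ for all $e$. For $\lambda>0$ put $\|u\|_\lambda^2=\int_{\mathcal G}|u'|^2\,dx+\lambda\int_{\mathcal G}|u|^2\,dx$. Let $$U(x)=\Big(\frac{p+1}{2}\Big)^{\frac1{p-1}}\Big[\cosh\Big(\frac{p-1}{2}x\Big)\Big]^{-\frac{2}{p-1}},$$ the even positive $H^1$ solution of $-U''+U=U^p$ on $\mathbb R$. Let $0<l<l_1$, let $\chi$ be a smooth cut-off function with $\chi=1$ on $[0,l/2]$ and $\chi=0$ on $[l,\infty)$, and set $$W_\lambda(x)=\chi(x)\,\lambda^{\frac1{p-1}}U(\sqrt\lambda\,x)\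 \text{ on } I_1,\qquad W_\lambda=0\ \text{ on }\mathcal G\setminus I_1 .$$ Then there is $\lambda_0>0$ such that for every $\lambda>\lambda_0$ there are $\rho=\rho(\lambda)>0$, $\phi=\phi_\lambda\in H^1(\mathcal G)$ and $u_\lambda=W_\lambda+\phi_\lambda$ such that $u_\lambda\in H^1(\mathcal G)$ is strictly positive on $\mathcal G$, is $C^2$ on every (closed) edge, and solves $$-u''+\lambda u=|u|^{p-1}u\ \text{ on every edge},\qquad \sum_{e\prec v}\frac{du_e}{dx}(v)=0\ \text{ for every vertex } v,\qquad |u|_{L^2(\mathcal G)}=\rho,$$ where the sum runs over the edge ends at $v$ and the derivatives are taken in the direction leaving $v$. Moreover $u_\lambda$ has a single peak at $v_1$: its maximum over $\mathcal G$ is attained at $v_1$ and only there. The family $(\phi_\lambda)$ satisfies, as $\lambda\to\infty$, $$\|\phi_\lambda\|_\lambda=O(\lambda^{-\alpha})\quad\text{for every }\alpha>0,$$ and the masses satisfy $$\rho(\lambda)^2=C\,\lambda^{\frac{5-p}{2(p-1)}}+o\Big(\lambda^{\frac{5-p}{2(p-1)}}\Big),\qquad C=\int_0^\infty U(x)^2\,dx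 .$$ -/

import Mathlib

open MeasureTheory Filter Set
open scoped ContDiff

noncomputable section

/-- A metric graph with vertex set `V` and edge set `E` (loops and multiple edges are allowed).
The edge `e` is identified with the interval `[0, len e]`, the coordinate `0` being glued to the
vertex `src e` and the coordinate `len e` to the vertex `tgt e`.
The graph is compact when `V` and `E` are finite. -/
structure MetricGraph (V E : Type*) where
  src : E → V
  tgt : E → V
  len : E → ℝ
  len_pos : ∀ e, 0 < len e

/-- `g` is a weak derivative of `f` on the interval `(0, l)`. -/
def IsWeakDeriv (l : ℝ) (f g : ℝ → ℝ) : Prop :=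
  ∀ ψ : ℝ → ℝ, ContDiff ℝ ∞ ψ → HasCompactSupport ψ → tsupport ψ ⊆ Ioo 0 l →
    ∫ x in Ioo 0 l, f x * deriv ψ x = -∫ x in Ioo 0 l, g x * ψ x

/-- `g` is a square-integrable weak derivative of `f` on `(0, l)`. -/
def IsWeakDerivL2 (l : ℝ) (f g : ℝ → ℝ) : Prop :=
  MemLp g 2 (volume.restrict (Ioo 0 l)) ∧ IsWeakDeriv l f g

/-- The Sobolev space `H¹(0, l)`. -/
def MemH1Interval (l : ℝ) (f : ℝ → ℝ) : Prop :=
  MemLp f 2 (volume.restrict (Ioo 0 l)) ∧ ∃ g, IsWeakDerivL2 l f g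

open Classical in
/-- A weak derivative of `f` on `(0, l)` (unique almost everywhere if `f` is in `H¹(0, l)`). -/
def weakDeriv (l : ℝ) (f : ℝ → ℝ) : ℝ → ℝ :=
  if h : ∃ g, IsWeakDerivL2 l f g then h.choose else 0

/-- The soliton: the even positive `H¹` solution of `-U'' + U = U ^ p` on `ℝ`. -/
def soliton (p x : ℝ) : ℝ :=
  ((p + 1) / 2) ^ (1 / (p - 1)) * (Real.cosh ((p - 1) / 2 * x)) ^ (-(2 / (p - 1)))

open Classical in
/-- The rescaled soliton on the edge `e₁`, extended by `0` to the other edges. -/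
def rescaledSoliton {E : Type*} (p lam : ℝ) (e₁ e : E) (x : ℝ) : ℝ :=
  if e = e₁ then lam ^ (1 / (p - 1)) * soliton p (Real.sqrt lam * x) else 0

/-- The rescaled soliton multiplied by the function `χ` of the coordinate of `e₁`. -/
def cutoffSoliton {E : Type*} (p lam : ℝ) (χ : ℝ → ℝ) (e₁ e : E) (x : ℝ) : ℝ :=
  χ x * rescaledSoliton p lam e₁ e x

/-- `χ` is a smooth cut-off function on `[0, ∞)`, equal to `1` on `[0, l / 2]` and to `0` on
`[l, ∞)`. -/
structure IsCutoff (l : ℝ) (χ : ℝ → ℝ) : Prop where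
  smooth : ContDiff ℝ ∞ χ
  eq_one : ∀ x, 0 ≤ x → x ≤ l / 2 → χ x = 1
  eq_zero : ∀ x, l ≤ x → χ x = 0

namespace MetricGraph

variable {V E : Type*} (G : MetricGraph V E)

/-- The interval `[0, len e]` identified with the edge `e`. -/
def edge (e : E) : Set ℝ := Icc 0 (G.len e)

/-- The degree of a vertex: the number of edge ends at it (a loop counts twice). -/
def degree (v : V) : ℕ := {e | G.src e = v}.ncard + {e | G.tgt e = v}.ncard

/-- Any two vertices are joined by a path of edges. -/
def IsConnected : Prop :=
  (SimpleGraph.fromRel fun v w => ∃ e, G.src e = v ∧ G.tgt e = w).Connected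

/-- Continuous functions on the graph; a function on the graph is a family `u = (u e)`, of which
only the values on the intervals `[0, len e]` matter. -/
def IsContinuous (u : E → ℝ → ℝ) : Prop :=
  (∀ e, ContinuousOn (u e) (G.edge e)) ∧
    ∃ val : V → ℝ, ∀ e, u e 0 = val (G.src e) ∧ u e (G.len e) = val (G.tgt e)

/-- The Sobolev space `H¹` of the graph. -/
def MemH1 (u : E → ℝ → ℝ) : Prop :=
  G.IsContinuous u ∧ ∀ e, MemH1Interval (G.len e) (u e)

/-- The outgoing derivative of `u` along the edge `e` at its initial point. -/
def outDerivSrc (u : E → ℝ → ℝ) (e : E) : ℝ := derivWithin (u e) (G.edge e) 0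

/-- The outgoing derivative of `u` along the edge `e` at its final point. -/
def outDerivTgt (u : E → ℝ → ℝ) (e : E) : ℝ := -derivWithin (u e) (G.edge e) (G.len e)

variable [Fintype E]

/-- The `L²` norm on the graph. -/
def l2Norm (u : E → ℝ → ℝ) : ℝ :=
  Real.sqrt (∑ e, ∫ x in Ioo 0 (G.len e), u e x ^ 2)

/-- The norm `‖u‖_lam`, where `‖u‖_lam² = ∫ u'² + lam ∫ u²`. -/
def lamNorm (lam : ℝ) (u : E → ℝ → ℝ) : ℝ :=
  Real.sqrt ((∑ e, ∫ x in Ioo 0 (G.len e), weakDeriv (G.len e) (u e) x ^ 2) +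
    lam * ∑ e, ∫ x in Ioo 0 (G.len e), u e x ^ 2)

open Classical in
/-- The Kirchhoff condition at the vertex `v`. -/
def KirchhoffAt (u : E → ℝ → ℝ) (v : V) : Prop :=
  (∑ e with G.src e = v, G.outDerivSrc u e) + (∑ e with G.tgt e = v, G.outDerivTgt u e) = 0

/-- `u` is a positive (classical) solution of `-u'' + lam u = |u|^(p-1) u` on the graph, with
Kirchhoff conditions at all vertices and `L²` norm equal to `ρ`. -/
structure IsPositiveSolution (p lam ρ : ℝ) (u : E → ℝ → ℝ) : Prop where
  memH1 : G.MemH1 u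
  contDiffOn : ∀ e, ContDiffOn ℝ 2 (u e) (G.edge e)
  equation : ∀ e, ∀ x ∈ G.edge e,
    -iteratedDerivWithin 2 (u e) (G.edge e) x + lam * u e x = |u e x| ^ (p - 1) * u e x
  kirchhoff : ∀ v, G.KirchhoffAt u v
  l2Norm_eq : G.l2Norm u = ρ
  pos : ∀ e, ∀ x ∈ G.edge e, 0 < u e x

end MetricGraph

end

/-!
Under `u(x) = λ ^ (1 / (p - 1)) * v(√λ * x)` the problem becomes `-v'' + v = |v| ^ (p - 1) * v` on
the graph stretched by `√λ`, so one may take `λ = 1` and all edges long. Write `v = U + φ`, where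
`U` is the half soliton on the pendant edge and zero elsewhere. On the pendant edge the equation
linearised at `U` has explicit decaying and growing solutions, the growing one of zero slope at the
tip; on the other edges `exp (-x)` and `exp x` play these roles. Variation of constants therefore
expresses `φ` through the nonlinear remainder and two amplitudes per edge, and when the edges are
long the vertex conditions determine the amplitudes up to exponentially small coupling. The
remainder being superlinear, a contraction argument yields `φ`, of the size `exp (-len e₁)` of the
failure of `U` to vanish at the end of its edge. The equation is first solved with `max v 0` in
the nonlinearity; then the minimum principle and connectedness give positivity. Closeness to `U`
away from the tip, and concavity near it, show that the tip is the only maximum point. Scaling back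
turns `exp (-len e₁)` into `exp (-√λ * len e₁)`, which is smaller than every power of `λ`.
-/

noncomputable section

open scoped Topology

/-! ### The equation linearised at the soliton -/

theorem le_of_hasDerivAt_le_of_le {f f' g g' : ℝ → ℝ} {a x : ℝ} (hf : ∀ y, HasDerivAt f (f' y) y)
    (hg : ∀ y, HasDerivAt g (g' y) y) (ha : f a ≤ g a) (hle : ∀ y, a ≤ y → f' y ≤ g' y)
    (hx : a ≤ x) : f x ≤ g x :=
  image_le_of_deriv_right_le_deriv_boundary (fun y _ => (hf y).continuousAt.continuousWithinAt)
    (fun y _ => (hf y).hasDerivWithinAt) ha (fun y _ => (hg y).continuousAt.continuousWithinAt)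
    (fun y _ => (hg y).hasDerivWithinAt) (fun y hy => hle y hy.1) ⟨hx, le_rfl⟩

theorem hasDerivAt_exp_const_mul (k x : ℝ) :
    HasDerivAt (fun y => Real.exp (k * y)) (k * Real.exp (k * x)) x := by
  simpa [mul_comm] using ((hasDerivAt_id x).const_mul k).exp

theorem one_sub_tanh_le (y : ℝ) : 1 - Real.tanh y ≤ 2 * Real.exp (-(2 * y)) := by
  have hexp : Real.exp (-(2 * y)) * Real.exp y = Real.exp (-y) := by
    rw [← Real.exp_add]; congr 1; ring
  rw [Real.tanh_eq, sub_le_iff_le_add, ← sub_le_iff_le_add', le_div_iff₀ (by positivity)]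
  nlinarith [mul_pos (Real.exp_pos (-(2 * y))) (Real.exp_pos (-y)), Real.exp_pos y]

theorem hasDerivAt_tanh_mul (c x : ℝ) :
    HasDerivAt (fun y => Real.tanh (c * y)) (c * (1 - Real.tanh (c * x) ^ 2)) x := by
  have hlin : HasDerivAt (fun y : ℝ => c * y) c x := by
    simpa using (hasDerivAt_id x).const_mul c
  have hcosh := (Real.cosh_pos (c * x)).ne'
  simp only [Real.tanh_eq_sinh_div_cosh]
  refine (hlin.sinh.div hlin.cosh hcosh).congr_deriv ?_
  field_simp

theorem tendsto_tanh_mul {c : ℝ} (hc : 0 < c) :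
    Tendsto (fun x => Real.tanh (c * x)) atTop (𝓝 1) := by
  have hexp : Tendsto (fun x : ℝ => Real.exp (-(2 * (c * x)))) atTop (𝓝 0) :=
    Real.tendsto_exp_neg_atTop_nhds_zero.comp
      ((tendsto_id.const_mul_atTop hc).const_mul_atTop two_pos)
  have hlim : Tendsto (fun x : ℝ => 1 - 2 * Real.exp (-(2 * (c * x)))) atTop (𝓝 1) := by
    simpa using (hexp.const_mul 2).const_sub 1
  exact tendsto_of_tendsto_of_tendsto_of_le_of_le hlim tendsto_const_nhds
    (fun x => sub_le_comm.1 (one_sub_tanh_le (c * x))) fun x => (Real.tanh_lt_one _).le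

/-- The growth profile `cosh (c x) ^ (1 / c)`, comparable to `exp |x|`. With `c = (p - 1) / 2` the
soliton is a constant multiple of its inverse. -/
def coshRoot (c x : ℝ) : ℝ := Real.cosh (c * x) ^ (1 / c)

/-- The primitive of `coshRoot c ^ 2` vanishing at `0`, which produces the second solution of the
linearised equation by reduction of order. -/
def coshRootInt (c x : ℝ) : ℝ := ∫ t in (0 : ℝ)..x, coshRoot c t ^ 2

/-- The decaying solution of the equation linearised at the soliton: a multiple of the derivative
of the soliton. -/
def decaySol (c x : ℝ) : ℝ := Real.tanh (c * x) / coshRoot c x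

/-- The derivative of `decaySol`. -/
def decaySolDeriv (c x : ℝ) : ℝ := (c - (c + 1) * Real.tanh (c * x) ^ 2) / coshRoot c x

/-- The growing solution, with zero slope at `0`, of the equation linearised at the soliton. -/
def growSol (c x : ℝ) : ℝ := (c + 2) * decaySol c x * coshRootInt c x - coshRoot c x

/-- The derivative of `growSol`. -/
def growSolDeriv (c x : ℝ) : ℝ :=
  (c + 2) * decaySolDeriv c x * coshRootInt c x + (c + 1) * Real.tanh (c * x) * coshRoot c x

/-- The potential `1 - p U ^ (p - 1)` of the equation linearised at the soliton `U`, for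
`p = 2 c + 1`. -/
def solitonPotential (c x : ℝ) : ℝ := 1 - (2 * c + 1) * (c + 1) * (1 - Real.tanh (c * x) ^ 2)

section LinearisedEquation

variable {c x : ℝ}

theorem coshRoot_pos (c x : ℝ) : 0 < coshRoot c x :=
  Real.rpow_pos_of_pos (Real.cosh_pos _) _

theorem hasDerivAt_coshRoot (hc : 0 < c) (x : ℝ) :
    HasDerivAt (coshRoot c) (Real.tanh (c * x) * coshRoot c x) x := by
  have hlin : HasDerivAt (fun y : ℝ => c * y) c x := by
    simpa using (hasDerivAt_id x).const_mul c
  have hcosh := (Real.cosh_pos (c * x)).ne'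
  refine (hlin.cosh.rpow_const (p := 1 / c) (Or.inl hcosh)).congr_deriv ?_
  rw [Real.rpow_sub_one hcosh, Real.tanh_eq_sinh_div_cosh, coshRoot]
  field_simp

theorem continuous_coshRoot (hc : 0 < c) : Continuous (coshRoot c) :=
  continuous_iff_continuousAt.2 fun x => (hasDerivAt_coshRoot hc x).continuousAt

theorem hasDerivAt_coshRootInt (hc : 0 < c) (x : ℝ) :
    HasDerivAt (coshRootInt c) (coshRoot c x ^ 2) x :=
  ((continuous_coshRoot hc).pow 2).integral_hasStrictDerivAt 0 x |>.hasDerivAt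

theorem hasDerivAt_decaySol (hc : 0 < c) (x : ℝ) :
    HasDerivAt (decaySol c) (decaySolDeriv c x) x := by
  have hR := (coshRoot_pos c x).ne'
  refine ((hasDerivAt_tanh_mul c x).div (hasDerivAt_coshRoot hc x) hR).congr_deriv ?_
  rw [decaySolDeriv]
  field_simp
  ring

theorem hasDerivAt_decaySolDeriv (hc : 0 < c) (x : ℝ) :
    HasDerivAt (decaySolDeriv c) (solitonPotential c x * decaySol c x) x := by
  have hR := (coshRoot_pos c x).ne'
  refine (((((hasDerivAt_tanh_mul c x).pow 2).const_mul (c + 1)).const_sub c).div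
    (hasDerivAt_coshRoot hc x) hR).congr_deriv ?_
  unfold solitonPotential decaySol
  field_simp
  simp only [Nat.cast_ofNat, Nat.add_one_sub_one, pow_one, Pi.pow_apply]
  ring

theorem hasDerivAt_growSol (hc : 0 < c) (x : ℝ) :
    HasDerivAt (growSol c) (growSolDeriv c x) x := by
  have := (coshRoot_pos c x).ne'
  refine ((((hasDerivAt_decaySol hc x).const_mul (c + 2)).mul
    (hasDerivAt_coshRootInt hc x)).sub (hasDerivAt_coshRoot hc x)).congr_deriv ?_
  unfold growSolDeriv decaySol
  field_simp
  ring

theorem hasDerivAt_growSolDeriv (hc : 0 < c) (x : ℝ) :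
    HasDerivAt (growSolDeriv c) (solitonPotential c x * growSol c x) x := by
  have hR := (coshRoot_pos c x).ne'
  refine ((((hasDerivAt_decaySolDeriv hc x).const_mul (c + 2)).mul
    (hasDerivAt_coshRootInt hc x)).add (((hasDerivAt_tanh_mul c x).const_mul (c + 1)).mul
    (hasDerivAt_coshRoot hc x))).congr_deriv ?_
  unfold growSol solitonPotential decaySol decaySolDeriv
  field_simp
  ring

theorem growSolDeriv_zero (c : ℝ) : growSolDeriv c 0 = 0 := by
  simp [growSolDeriv, coshRootInt]

theorem growSol_wronskian (c x : ℝ) :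
    growSolDeriv c x * decaySol c x - growSol c x * decaySolDeriv c x = c := by
  have hR := (coshRoot_pos c x).ne'
  unfold growSol growSolDeriv decaySol decaySolDeriv
  field_simp
  ring

theorem coshRoot_le_exp (hc : 0 < c) (hx : 0 ≤ x) : coshRoot c x ≤ Real.exp x := by
  have hcosh : Real.cosh (c * x) ≤ Real.exp (c * x) := by
    have : Real.exp (-(c * x)) ≤ Real.exp (c * x) :=
      Real.exp_le_exp.2 (neg_le_self (by positivity))
    rw [Real.cosh_eq]
    linarith
  calc coshRoot c x ≤ Real.exp (c * x) ^ (1 / c) :=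
        Real.rpow_le_rpow (Real.cosh_pos _).le hcosh (by positivity)
    _ = Real.exp x := by
        rw [← Real.exp_mul]; congr 1; field_simp

theorem coshRoot_sq_le_exp (hc : 0 < c) (hx : 0 ≤ x) : coshRoot c x ^ 2 ≤ Real.exp (2 * x) := by
  calc coshRoot c x ^ 2 ≤ Real.exp x ^ 2 := by
        gcongr
        exacts [(coshRoot_pos c x).le, coshRoot_le_exp hc hx]
    _ = Real.exp (2 * x) := by rw [← Real.exp_nat_mul, Nat.cast_ofNat]

theorem exp_le_coshRoot (hc : 0 < c) (x : ℝ) : Real.exp x ≤ 2 ^ (1 / c) * coshRoot c x := by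
  have hcosh : Real.exp (c * x) ≤ 2 * Real.cosh (c * x) := by
    rw [Real.cosh_eq]
    linarith [Real.exp_pos (-(c * x))]
  calc Real.exp x = Real.exp (c * x) ^ (1 / c) := by
        rw [← Real.exp_mul]; congr 1; field_simp
    _ ≤ (2 * Real.cosh (c * x)) ^ (1 / c) :=
        Real.rpow_le_rpow (Real.exp_pos _).le hcosh (by positivity)
    _ = 2 ^ (1 / c) * coshRoot c x := Real.mul_rpow (by norm_num) (Real.cosh_pos _).le

theorem inv_coshRoot_le (hc : 0 < c) (x : ℝ) :
    (coshRoot c x)⁻¹ ≤ 2 ^ (1 / c) * Real.exp (-x) := by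
  have hR := coshRoot_pos c x
  rw [inv_le_iff_one_le_mul₀ hR, Real.exp_neg, mul_right_comm, ← div_eq_mul_inv,
    one_le_div (Real.exp_pos x)]
  exact exp_le_coshRoot hc x

theorem abs_decaySol_le (hc : 0 < c) (x : ℝ) :
    |decaySol c x| ≤ 2 ^ (1 / c) * Real.exp (-x) := by
  rw [decaySol, abs_div, abs_of_pos (coshRoot_pos c x), div_eq_mul_inv]
  calc |Real.tanh (c * x)| * (coshRoot c x)⁻¹ ≤ 1 * (2 ^ (1 / c) * Real.exp (-x)) := by
        gcongr
        exacts [inv_nonneg.2 (coshRoot_pos c x).le, (Real.abs_tanh_lt_one _).le,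
          inv_coshRoot_le hc x]
    _ = 2 ^ (1 / c) * Real.exp (-x) := one_mul _

theorem abs_decaySolDeriv_le (hc : 0 < c) (x : ℝ) :
    |decaySolDeriv c x| ≤ (c + 1) * (2 ^ (1 / c) * Real.exp (-x)) := by
  have hnum : |c - (c + 1) * Real.tanh (c * x) ^ 2| ≤ c + 1 := by
    have hlt := Real.tanh_sq_lt_one (c * x)
    rw [abs_le]; constructor <;> nlinarith [sq_nonneg (Real.tanh (c * x))]
  rw [decaySolDeriv, abs_div, abs_of_pos (coshRoot_pos c x), div_eq_mul_inv]
  gcongr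
  exacts [inv_nonneg.2 (coshRoot_pos c x).le, inv_coshRoot_le hc x]

theorem coshRootInt_nonneg (hx : 0 ≤ x) : 0 ≤ coshRootInt c x :=
  intervalIntegral.integral_nonneg hx fun _ _ => sq_nonneg _

theorem coshRootInt_le_exp (hc : 0 < c) (hx : 0 ≤ x) : coshRootInt c x ≤ Real.exp (2 * x) := by
  refine le_of_hasDerivAt_le_of_le (hasDerivAt_coshRootInt hc) (hasDerivAt_exp_const_mul 2)
    (by simp [coshRootInt]) (fun y hy => ?_) hx
  linarith [coshRoot_sq_le_exp hc hy, Real.exp_pos (2 * y)]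

theorem abs_growSol_le (hc : 0 < c) (hx : 0 ≤ x) :
    |growSol c x| ≤ ((c + 2) * 2 ^ (1 / c) + 1) * Real.exp x := by
  have hJ : |coshRootInt c x| ≤ Real.exp x * Real.exp x := by
    rw [abs_of_nonneg (coshRootInt_nonneg hx), ← Real.exp_add, ← two_mul]
    exact coshRootInt_le_exp hc hx
  have hR : |coshRoot c x| ≤ Real.exp x := by
    rw [abs_of_pos (coshRoot_pos c x)]; exact coshRoot_le_exp hc hx
  have hc2 : |c + 2| = c + 2 := abs_of_pos (by linarith)
  calc |growSol c x| ≤ (c + 2) * |decaySol c x| * |coshRootInt c x| + |coshRoot c x| := by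
        rw [growSol]
        exact (abs_sub _ _).trans_eq (by rw [abs_mul, abs_mul, hc2])
    _ ≤ (c + 2) * (2 ^ (1 / c) * Real.exp (-x)) * (Real.exp x * Real.exp x) + Real.exp x := by
        gcongr; exact abs_decaySol_le hc x
    _ = ((c + 2) * 2 ^ (1 / c) + 1) * Real.exp x := by
        rw [Real.exp_neg]; field_simp

theorem abs_growSolDeriv_le (hc : 0 < c) (hx : 0 ≤ x) :
    |growSolDeriv c x| ≤ (c + 1) * ((c + 2) * 2 ^ (1 / c) + 1) * Real.exp x := by
  have hJ : |coshRootInt c x| ≤ Real.exp x * Real.exp x := by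
    rw [abs_of_nonneg (coshRootInt_nonneg hx), ← Real.exp_add, ← two_mul]
    exact coshRootInt_le_exp hc hx
  have hR : |coshRoot c x| ≤ Real.exp x := by
    rw [abs_of_pos (coshRoot_pos c x)]; exact coshRoot_le_exp hc hx
  have hc1 : |c + 1| = c + 1 := abs_of_pos (by linarith)
  have hc2 : |c + 2| = c + 2 := abs_of_pos (by linarith)
  calc |growSolDeriv c x| ≤ (c + 2) * |decaySolDeriv c x| * |coshRootInt c x|
          + (c + 1) * |Real.tanh (c * x)| * |coshRoot c x| := by
        rw [growSolDeriv]
        exact (abs_add_le _ _).trans_eq (by simp only [abs_mul, hc1, hc2])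
    _ ≤ (c + 2) * ((c + 1) * (2 ^ (1 / c) * Real.exp (-x))) * (Real.exp x * Real.exp x)
          + (c + 1) * 1 * Real.exp x := by
        gcongr
        exacts [abs_decaySolDeriv_le hc x, (Real.abs_tanh_lt_one _).le]
    _ = (c + 1) * ((c + 2) * 2 ^ (1 / c) + 1) * Real.exp x := by
        rw [Real.exp_neg]; field_simp

theorem hasDerivAt_half_coshRoot_sq (hc : 0 < c) (x : ℝ) :
    HasDerivAt (fun y => coshRoot c y ^ 2 / 2) (Real.tanh (c * x) * coshRoot c x ^ 2) x := by
  refine (((hasDerivAt_coshRoot hc x).pow 2).div_const 2).congr_deriv ?_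
  push_cast
  ring

theorem half_coshRoot_sq_le_coshRootInt_add_one (hc : 0 < c) (hx : 0 ≤ x) :
    coshRoot c x ^ 2 / 2 ≤ coshRootInt c x + 1 := by
  refine le_of_hasDerivAt_le_of_le (hasDerivAt_half_coshRoot_sq hc)
    (fun y => (hasDerivAt_coshRootInt hc y).add_const 1) ?_ (fun y _ => ?_) hx
  · norm_num [coshRootInt, coshRoot]
  · nlinarith [(Real.tanh_lt_one (c * y)).le, sq_nonneg (coshRoot c y)]

theorem coshRootInt_le_half_coshRoot_sq_add_exp {σ : ℝ} (hc : 0 < c) (hσ : σ ≤ 1)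
    (hσc : σ ≤ 2 * c) (hx : 0 ≤ x) :
    coshRootInt c x ≤ coshRoot c x ^ 2 / 2 + 2 * Real.exp ((2 - σ) * x) := by
  refine le_of_hasDerivAt_le_of_le (hasDerivAt_coshRootInt hc) (fun y =>
    (hasDerivAt_half_coshRoot_sq hc y).add ((hasDerivAt_exp_const_mul (2 - σ) y).const_mul 2))
    ?_ (fun y hy => ?_) hx
  · norm_num [coshRootInt, coshRoot]
  · have hderiv : (1 - Real.tanh (c * y)) * coshRoot c y ^ 2 ≤ 2 * Real.exp ((2 - σ) * y) :=
      calc (1 - Real.tanh (c * y)) * coshRoot c y ^ 2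
          ≤ 2 * Real.exp (-(2 * (c * y))) * Real.exp (2 * y) :=
            mul_le_mul (one_sub_tanh_le _) (coshRoot_sq_le_exp hc hy) (by positivity)
              (by positivity)
        _ = 2 * Real.exp ((2 - 2 * c) * y) := by
            rw [mul_assoc, ← Real.exp_add]; congr 2; ring
        _ ≤ 2 * Real.exp ((2 - σ) * y) := by gcongr
    nlinarith [Real.exp_pos ((2 - σ) * y)]

theorem tendsto_coshRootInt_div (hc : 0 < c) :
    Tendsto (fun x => coshRootInt c x / coshRoot c x ^ 2) atTop (𝓝 (1 / 2)) := by
  obtain ⟨σ, hσ, hσ1, hσc⟩ : ∃ σ > 0, σ ≤ 1 ∧ σ ≤ 2 * c :=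
    ⟨min 1 (2 * c), by positivity, min_le_left _ _, min_le_right _ _⟩
  have hexp : Tendsto (fun x : ℝ => Real.exp (-(σ * x))) atTop (𝓝 0) :=
    Real.tendsto_exp_neg_atTop_nhds_zero.comp (tendsto_id.const_mul_atTop hσ)
  have hlim : Tendsto (fun x => (2 ^ (1 / c)) ^ 2 * 2 * Real.exp (-(σ * x))) atTop (𝓝 0) := by
    simpa using hexp.const_mul ((2 ^ (1 / c) : ℝ) ^ 2 * 2)
  rw [tendsto_iff_dist_tendsto_zero]
  refine squeeze_zero' (Eventually.of_forall fun _ => dist_nonneg) ?_ hlim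
  filter_upwards [eventually_ge_atTop 0] with x hx
  have hR := coshRoot_pos c x
  have hdiff : |coshRootInt c x - coshRoot c x ^ 2 / 2| ≤ 2 * Real.exp ((2 - σ) * x) := by
    have hone : 1 ≤ Real.exp ((2 - σ) * x) := Real.one_le_exp (by nlinarith)
    rw [abs_le]
    constructor
    · linarith [half_coshRoot_sq_le_coshRootInt_add_one hc hx]
    · linarith [coshRootInt_le_half_coshRoot_sq_add_exp hc hσ1 hσc hx]
  calc dist (coshRootInt c x / coshRoot c x ^ 2) (1 / 2)
      = |coshRootInt c x - coshRoot c x ^ 2 / 2| * (coshRoot c x)⁻¹ ^ 2 := by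
        rw [Real.dist_eq, ← abs_of_pos (show 0 < (coshRoot c x)⁻¹ ^ 2 by positivity), ← abs_mul]
        congr 1; field_simp
    _ ≤ 2 * Real.exp ((2 - σ) * x) * (2 ^ (1 / c) * Real.exp (-x)) ^ 2 := by
        gcongr; exact inv_coshRoot_le hc x
    _ = (2 ^ (1 / c)) ^ 2 * 2 * (Real.exp ((2 - σ) * x) * Real.exp (-x) ^ 2) := by ring
    _ = (2 ^ (1 / c)) ^ 2 * 2 * Real.exp (-(σ * x)) := by
        rw [← Real.exp_nat_mul, ← Real.exp_add]; congr 2; push_cast; ring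

theorem tendsto_growSol_div (hc : 0 < c) :
    Tendsto (fun x => growSol c x / coshRoot c x) atTop (𝓝 (c / 2)) := by
  have hlim := (((tendsto_tanh_mul hc).mul (tendsto_coshRootInt_div hc)).const_mul
    (c + 2)).sub_const 1
  rw [show (c + 2) * (1 * (1 / 2)) - 1 = c / 2 by ring] at hlim
  refine hlim.congr fun x => ?_
  have hR := (coshRoot_pos c x).ne'
  unfold growSol decaySol
  field_simp

theorem tendsto_growSolDeriv_div (hc : 0 < c) :
    Tendsto (fun x => growSolDeriv c x / coshRoot c x) atTop (𝓝 (c / 2)) := by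
  have hlim := (((((tendsto_tanh_mul hc).pow 2).const_mul (c + 1)).const_sub c).mul
    (tendsto_coshRootInt_div hc)).const_mul (c + 2) |>.add
    ((tendsto_tanh_mul hc).const_mul (c + 1))
  rw [show (c + 2) * ((c - (c + 1) * 1 ^ 2) * (1 / 2)) + (c + 1) * 1 = c / 2 by ring] at hlim
  refine hlim.congr fun x => ?_
  have hR := (coshRoot_pos c x).ne'
  unfold growSolDeriv decaySolDeriv
  field_simp

end LinearisedEquation

/-- The derivative of the soliton. -/
def solitonDeriv (p x : ℝ) : ℝ := -(Real.tanh ((p - 1) / 2 * x) * soliton p x)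

/-- The superlinear remainder of the nonlinearity `y ↦ (max y 0) ^ p` at `b`. -/
def powRemainder (p b t : ℝ) : ℝ := max (b + t) 0 ^ p - b ^ p - p * b ^ (p - 1) * t

section Soliton

variable {p : ℝ}

theorem soliton_eq (p x : ℝ) :
    soliton p x = ((p + 1) / 2) ^ (1 / (p - 1)) * (coshRoot ((p - 1) / 2) x)⁻¹ := by
  rw [soliton, coshRoot, Real.rpow_neg (Real.cosh_pos _).le, one_div_div]

theorem soliton_pos (hp : 1 < p) (x : ℝ) : 0 < soliton p x := by
  rw [soliton_eq]
  exact mul_pos (Real.rpow_pos_of_pos (by linarith) _) (inv_pos.2 (coshRoot_pos _ _))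

theorem soliton_rpow_sub_one (hp : 1 < p) (x : ℝ) :
    soliton p x ^ (p - 1) = (p + 1) / 2 * (1 - Real.tanh ((p - 1) / 2 * x) ^ 2) := by
  have hcosh := Real.cosh_pos ((p - 1) / 2 * x)
  have hp1 : p - 1 ≠ 0 := by linarith
  rw [soliton, Real.mul_rpow (Real.rpow_nonneg (by linarith) _) (Real.rpow_nonneg hcosh.le _),
    ← Real.rpow_mul (by linarith), ← Real.rpow_mul hcosh.le, one_div_mul_cancel hp1,
    neg_mul, div_mul_cancel₀ _ hp1, Real.rpow_one, Real.rpow_neg hcosh.le, Real.rpow_two,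
    Real.tanh_eq_sinh_div_cosh, div_pow, Real.sinh_sq]
  field_simp
  ring

theorem solitonPotential_eq (hp : 1 < p) (x : ℝ) :
    solitonPotential ((p - 1) / 2) x = 1 - p * soliton p x ^ (p - 1) := by
  rw [soliton_rpow_sub_one hp, solitonPotential]; ring

theorem hasDerivAt_soliton (hp : 1 < p) (x : ℝ) :
    HasDerivAt (soliton p) (solitonDeriv p x) x := by
  have hR := (coshRoot_pos ((p - 1) / 2) x).ne'
  rw [solitonDeriv, funext (soliton_eq p)]
  refine (((hasDerivAt_coshRoot (by linarith) x).inv hR).const_mul _).congr_deriv ?_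
  field_simp

theorem hasDerivAt_solitonDeriv (hp : 1 < p) (x : ℝ) :
    HasDerivAt (solitonDeriv p) (soliton p x - soliton p x ^ p) x := by
  have hpow : soliton p x ^ p = soliton p x ^ (p - 1) * soliton p x := by
    rw [Real.rpow_sub_one (soliton_pos hp x).ne', div_mul_cancel₀ _ (soliton_pos hp x).ne']
  refine ((hasDerivAt_tanh_mul ((p - 1) / 2) x).mul (hasDerivAt_soliton hp x)).neg.congr_deriv ?_
  rw [hpow, soliton_rpow_sub_one hp, solitonDeriv]
  ring

theorem solitonDeriv_zero (p : ℝ) : solitonDeriv p 0 = 0 := by simp [solitonDeriv]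

theorem continuous_soliton (hp : 1 < p) : Continuous (soliton p) :=
  continuous_iff_continuousAt.2 fun x => (hasDerivAt_soliton hp x).continuousAt

theorem soliton_le_exp (hp : 1 < p) (x : ℝ) : soliton p x ≤
    ((p + 1) / 2) ^ (1 / (p - 1)) * 2 ^ (1 / ((p - 1) / 2)) * Real.exp (-x) := by
  rw [soliton_eq, mul_assoc]
  gcongr
  exact inv_coshRoot_le (by linarith) x

theorem abs_solitonDeriv_le_soliton (hp : 1 < p) (x : ℝ) : |solitonDeriv p x| ≤ soliton p x := by
  rw [solitonDeriv, abs_neg, abs_mul, abs_of_pos (soliton_pos hp x)]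
  exact mul_le_of_le_one_left (soliton_pos hp x).le (Real.abs_tanh_lt_one _).le

theorem soliton_strictAntiOn (hp : 1 < p) : StrictAntiOn (soliton p) (Ici 0) := by
  refine strictAntiOn_of_deriv_neg (convex_Ici 0) (continuous_soliton hp).continuousOn
    fun y hy => ?_
  rw [interior_Ici, mem_Ioi] at hy
  have harg : 0 < (p - 1) / 2 * y := mul_pos (by linarith) hy
  have htanh : 0 < Real.tanh ((p - 1) / 2 * y) := by
    rw [Real.tanh_eq_sinh_div_cosh]
    exact div_pos (Real.sinh_pos_iff.2 harg) (Real.cosh_pos _)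
  rw [(hasDerivAt_soliton hp y).deriv, solitonDeriv, neg_lt_zero]
  exact mul_pos htanh (soliton_pos hp y)

theorem soliton_le_soliton_zero (hp : 1 < p) (x : ℝ) : soliton p x ≤ soliton p 0 := by
  have hexp : 0 ≤ 2 / (p - 1) := div_nonneg two_pos.le (by linarith)
  have h := Real.rpow_le_one_of_one_le_of_nonpos (Real.one_le_cosh ((p - 1) / 2 * x))
    (neg_nonpos.2 hexp)
  simp only [soliton, mul_zero, Real.cosh_zero, Real.one_rpow]
  gcongr

theorem one_lt_soliton_zero (hp : 1 < p) : 1 < soliton p 0 := by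
  simp only [soliton, mul_zero, Real.cosh_zero, Real.one_rpow, mul_one]
  exact Real.one_lt_rpow (by linarith) (one_div_pos.2 (by linarith))

theorem continuous_max_zero_rpow (hp : 0 ≤ p) : Continuous fun y : ℝ => max y 0 ^ p :=
  (continuous_id.max continuous_const).rpow_const fun _ => Or.inr hp

theorem hasDerivAt_max_zero_rpow (hp : 1 < p) (x : ℝ) :
    HasDerivAt (fun y : ℝ => max y 0 ^ p) (p * max x 0 ^ (p - 1)) x := by
  have hne : ∀ y ≠ 0, HasDerivAt (fun y : ℝ => max y 0 ^ p) (p * max y 0 ^ (p - 1)) y := by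
    intro y hy
    rcases hy.lt_or_gt with hy | hy
    · rw [max_eq_right hy.le, Real.zero_rpow (by linarith), mul_zero]
      refine (hasDerivAt_const y (0 : ℝ)).congr_of_eventuallyEq ?_
      filter_upwards [eventually_lt_nhds hy] with z hz
      rw [max_eq_right hz.le, Real.zero_rpow (by linarith)]
    · rw [max_eq_left hy.le]
      refine (Real.hasDerivAt_rpow_const (Or.inl hy.ne')).congr_of_eventuallyEq ?_
      filter_upwards [eventually_gt_nhds hy] with z hz
      rw [max_eq_left hz.le]
  rcases eq_or_ne x 0 with rfl | hx
  · exact hasDerivAt_of_hasDerivAt_of_ne hne (continuous_max_zero_rpow (by linarith)).continuousAt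
      ((continuous_max_zero_rpow (by linarith)).const_mul p).continuousAt
  · exact hne x hx

theorem powRemainder_zero {b : ℝ} (p : ℝ) (hb : 0 ≤ b) : powRemainder p b 0 = 0 := by
  simp [powRemainder, max_eq_left hb]

theorem hasDerivAt_powRemainder (hp : 1 < p) (b t : ℝ) :
    HasDerivAt (powRemainder p b) (p * max (b + t) 0 ^ (p - 1) - p * b ^ (p - 1)) t := by
  have hmax := (hasDerivAt_max_zero_rpow hp (b + t)).comp t ((hasDerivAt_id t).const_add b)
  refine ((hmax.sub_const (b ^ p)).sub
    ((hasDerivAt_id t).const_mul (p * b ^ (p - 1)))).congr_deriv ?_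
  simp only [mul_one]

theorem exists_powRemainder_lipschitz (hp : 1 < p) (A : ℝ) {ε : ℝ} (hε : 0 < ε) :
    ∃ δ > 0, ∀ b ∈ Icc 0 A, ∀ s ∈ Icc (-δ) δ, ∀ t ∈ Icc (-δ) δ,
      |powRemainder p b s - powRemainder p b t| ≤ ε * |s - t| := by
  have hp0 : 0 < p := by linarith
  have hunif := (isCompact_Icc (a := (-1 : ℝ)) (b := A + 1)).uniformContinuousOn_of_continuous
    (continuous_max_zero_rpow (sub_nonneg.2 hp.le)).continuousOn
  obtain ⟨η, hη, hclose⟩ := Metric.uniformContinuousOn_iff.1 hunif (ε / p) (div_pos hε hp0)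
  refine ⟨min (η / 2) 1, by positivity, fun b hb s hs t ht => ?_⟩
  refine (convex_Icc _ _).norm_image_sub_le_of_norm_hasDerivWithin_le
    (fun y _ => (hasDerivAt_powRemainder hp b y).hasDerivWithinAt) (fun y hy => ?_) ht hs
  have hyη : |y| ≤ η / 2 := (abs_le.2 hy).trans (min_le_left _ _)
  have hy1 := abs_le.1 ((abs_le.2 hy).trans (min_le_right _ _))
  have hdist := hclose (b + y) ⟨by linarith [hb.1], by linarith [hb.2]⟩ b
    ⟨by linarith [hb.1], by linarith [hb.2]⟩ (by rw [Real.dist_eq, add_sub_cancel_left]; linarith)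
  rw [Real.dist_eq, max_eq_left hb.1, lt_div_iff₀' hp0] at hdist
  rw [← mul_sub, Real.norm_eq_abs, abs_mul, abs_of_pos hp0]
  exact hdist.le

theorem continuous_powRemainder {X : Type*} [TopologicalSpace X] (hp : 1 < p)
    {b t : X → ℝ} (hb : Continuous b) (ht : Continuous t) :
    Continuous fun x => powRemainder p (b x) (t x) :=
  (((continuous_max_zero_rpow (by linarith)).comp (hb.add ht)).sub
    (hb.rpow_const fun _ => Or.inr (by linarith))).sub
    ((continuous_const.mul (hb.rpow_const fun _ => Or.inr (by linarith))).mul ht)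

end Soliton

/-! ### Variation of constants -/

/-- A pair of solutions `P` (decaying) and `Q` (growing) of `z'' = q z` with constant
Wronskian `w`, with derivatives `P'` and `Q'`. The exponential bounds hold with constant `K` on
`[0, ∞)`, and `Q`, `Q'` grow exponentially from `L₀` on. -/
structure FundamentalSystem (K L₀ : ℝ) where
  q : ℝ → ℝ
  P : ℝ → ℝ
  P' : ℝ → ℝ
  Q : ℝ → ℝ
  Q' : ℝ → ℝ
  w : ℝ
  hasDerivAt_P : ∀ x, HasDerivAt P (P' x) x
  hasDerivAt_P' : ∀ x, HasDerivAt P' (q x * P x) x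
  hasDerivAt_Q : ∀ x, HasDerivAt Q (Q' x) x
  hasDerivAt_Q' : ∀ x, HasDerivAt Q' (q x * Q x) x
  wronskian : ∀ x, Q' x * P x - Q x * P' x = w
  w_pos : 0 < w
  inv_w_le : w⁻¹ ≤ K
  abs_P_le : ∀ x, 0 ≤ x → |P x| ≤ K * Real.exp (-x)
  abs_P'_le : ∀ x, 0 ≤ x → |P' x| ≤ K * Real.exp (-x)
  abs_Q_le : ∀ x, 0 ≤ x → |Q x| ≤ K * Real.exp x
  abs_Q'_le : ∀ x, 0 ≤ x → |Q' x| ≤ K * Real.exp x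
  Q_le_Q' : ∀ x, L₀ ≤ x → Q x ≤ K * Q' x
  exp_le_Q : ∀ x, L₀ ≤ x → Real.exp x ≤ K * Q x

/-- The fundamental system `exp (-x)`, `exp x` of `z'' = z`. -/
def expSystem {K : ℝ} (hK : 1 ≤ K) (L₀ : ℝ) : FundamentalSystem K L₀ where
  q _ := 1
  P x := Real.exp (-x)
  P' x := -Real.exp (-x)
  Q := Real.exp
  Q' := Real.exp
  w := 2
  hasDerivAt_P x := by simpa using (hasDerivAt_id x).neg.exp
  hasDerivAt_P' x := by simpa using (hasDerivAt_id x).fun_neg.exp.fun_neg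
  hasDerivAt_Q := Real.hasDerivAt_exp
  hasDerivAt_Q' x := by simpa using Real.hasDerivAt_exp x
  wronskian x := by
    have hexp : Real.exp x * Real.exp (-x) = 1 := by
      rw [← Real.exp_add, add_neg_cancel, Real.exp_zero]
    linarith
  w_pos := two_pos
  inv_w_le := by linarith
  abs_P_le x _ := by
    rw [Real.abs_exp]; exact le_mul_of_one_le_left (Real.exp_pos _).le hK
  abs_P'_le x _ := by
    rw [abs_neg, Real.abs_exp]; exact le_mul_of_one_le_left (Real.exp_pos _).le hK
  abs_Q_le x _ := by
    rw [Real.abs_exp]; exact le_mul_of_one_le_left (Real.exp_pos _).le hK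
  abs_Q'_le x _ := by
    rw [Real.abs_exp]; exact le_mul_of_one_le_left (Real.exp_pos _).le hK
  exp_le_Q x _ := le_mul_of_one_le_left (Real.exp_pos _).le hK
  Q_le_Q' x _ := le_mul_of_one_le_left (Real.exp_pos _).le hK

theorem eventually_exp_le_growSol {c : ℝ} (hc : 0 < c) :
    ∀ᶠ x in atTop, Real.exp x ≤ 4 / c * 2 ^ (1 / c) * growSol c x := by
  filter_upwards [(tendsto_growSol_div hc).eventually (lt_mem_nhds
    (show c / 4 < c / 2 by linarith))] with x hx
  rw [lt_div_iff₀ (coshRoot_pos c x)] at hx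
  calc Real.exp x ≤ 2 ^ (1 / c) * coshRoot c x := exp_le_coshRoot hc x
    _ = 4 / c * 2 ^ (1 / c) * (c / 4 * coshRoot c x) := by field_simp
    _ ≤ 4 / c * 2 ^ (1 / c) * growSol c x := by gcongr

theorem eventually_growSol_le_growSolDeriv {c : ℝ} (hc : 0 < c) :
    ∀ᶠ x in atTop, growSol c x ≤ 4 * growSolDeriv c x := by
  filter_upwards [(tendsto_growSol_div hc).eventually (gt_mem_nhds
    (show c / 2 < c by linarith)), (tendsto_growSolDeriv_div hc).eventually (lt_mem_nhds
    (show c / 4 < c / 2 by linarith))] with x hgrow hderiv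
  rw [div_lt_iff₀ (coshRoot_pos c x)] at hgrow
  rw [lt_div_iff₀ (coshRoot_pos c x)] at hderiv
  linarith

theorem exists_solitonSystem {c : ℝ} (hc : 0 < c) : ∃ L₀ : ℝ, ∀ᶠ K in atTop,
    ∃ D : FundamentalSystem K L₀, D.q = solitonPotential c ∧ D.Q' 0 = 0 := by
  obtain ⟨L₀, hL₀⟩ := eventually_atTop.1
    ((eventually_exp_le_growSol hc).and (eventually_growSol_le_growSolDeriv hc))
  refine ⟨max L₀ 0, ?_⟩
  filter_upwards [eventually_ge_atTop c⁻¹, eventually_ge_atTop (2 ^ (1 / c)),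
    eventually_ge_atTop ((c + 1) * 2 ^ (1 / c)),
    eventually_ge_atTop ((c + 2) * 2 ^ (1 / c) + 1),
    eventually_ge_atTop ((c + 1) * ((c + 2) * 2 ^ (1 / c) + 1)),
    eventually_ge_atTop (4 / c * 2 ^ (1 / c)), eventually_ge_atTop 4]
    with K hw hP hP' hQ hQ' hexp hgrow
  have hgrow_pos {x : ℝ} (hx : max L₀ 0 ≤ x) : 0 < growSol c x :=
    pos_of_mul_pos_right ((Real.exp_pos x).trans_le (hL₀ x (le_of_max_le_left hx)).1)
      (by positivity)
  have hgrow_deriv {x : ℝ} (hx : max L₀ 0 ≤ x) : growSol c x ≤ 4 * growSolDeriv c x :=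
    (hL₀ x (le_of_max_le_left hx)).2
  refine ⟨{ q := solitonPotential c, P := decaySol c, P' := decaySolDeriv c
            Q := growSol c, Q' := growSolDeriv c, w := c
            hasDerivAt_P := hasDerivAt_decaySol hc
            hasDerivAt_P' := hasDerivAt_decaySolDeriv hc
            hasDerivAt_Q := hasDerivAt_growSol hc
            hasDerivAt_Q' := hasDerivAt_growSolDeriv hc
            wronskian := growSol_wronskian c
            w_pos := hc
            inv_w_le := hw
            abs_P_le := fun x _ => (abs_decaySol_le hc x).trans (by gcongr)
            abs_P'_le := fun x _ => (abs_decaySolDeriv_le hc x).trans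
              (by rw [← mul_assoc]; gcongr)
            abs_Q_le := fun x hx => (abs_growSol_le hc hx).trans (by gcongr)
            abs_Q'_le := fun x hx => (abs_growSolDeriv_le hc hx).trans (by gcongr)
            exp_le_Q := fun x hx => (hL₀ x (le_of_max_le_left hx)).1.trans
              (mul_le_mul_of_nonneg_right hexp (hgrow_pos hx).le)
            Q_le_Q' := fun x hx => (hgrow_deriv hx).trans
              (mul_le_mul_of_nonneg_right hgrow
                (by linarith [hgrow_pos hx, hgrow_deriv hx])) }, rfl, growSolDeriv_zero c⟩

namespace FundamentalSystem

variable {K L₀ : ℝ} (D : FundamentalSystem K L₀)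

theorem K_pos (D : FundamentalSystem K L₀) : 0 < K := (inv_pos.2 D.w_pos).trans_le D.inv_w_le

theorem continuous_P : Continuous D.P :=
  continuous_iff_continuousAt.2 fun x => (D.hasDerivAt_P x).continuousAt

theorem continuous_Q : Continuous D.Q :=
  continuous_iff_continuousAt.2 fun x => (D.hasDerivAt_Q x).continuousAt

/-- The logarithmic derivative of the growing solution. -/
def slope (L : ℝ) : ℝ := D.Q' L / D.Q L

/-- The coefficient `w⁻¹ ∫ Q f` over `[0, x]` of `P` in the variation of constants formula. -/
def intQ (f : ℝ → ℝ) (x : ℝ) : ℝ := D.w⁻¹ * ∫ y in (0 : ℝ)..x, D.Q y * f y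

/-- The coefficient `w⁻¹ ∫ P f` over `[x, L]` of `Q` in the variation of constants formula. -/
def intP (L : ℝ) (f : ℝ → ℝ) (x : ℝ) : ℝ := D.w⁻¹ * ∫ y in x..L, D.P y * f y

/-- The solution of `z'' = q z - f` on `[0, L]` given by variation of constants, with amplitudes
`a` of `P` at `0` and `b` of the growing solution, normalised to have value `b` at `L`. -/
def sol (L a b : ℝ) (f : ℝ → ℝ) (x : ℝ) : ℝ :=
  (a + D.intQ f x) * D.P x + (b / D.Q L + D.intP L f x) * D.Q x

/-- The derivative of `sol`. -/
def solDeriv (L a b : ℝ) (f : ℝ → ℝ) (x : ℝ) : ℝ :=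
  (a + D.intQ f x) * D.P' x + (b / D.Q L + D.intP L f x) * D.Q' x

section Positivity

variable {L : ℝ}

theorem Q_pos (hL : L₀ ≤ L) : 0 < D.Q L :=
  pos_of_mul_pos_right ((Real.exp_pos L).trans_le (D.exp_le_Q L hL)) D.K_pos.le

theorem Q'_pos (hL : L₀ ≤ L) : 0 < D.Q' L :=
  pos_of_mul_pos_right ((D.Q_pos hL).trans_le (D.Q_le_Q' L hL)) D.K_pos.le

theorem slope_pos (hL : L₀ ≤ L) : 0 < D.slope L := div_pos (D.Q'_pos hL) (D.Q_pos hL)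

theorem one_le_mul_slope (hL : L₀ ≤ L) : 1 ≤ K * D.slope L := by
  rw [slope, ← mul_div_assoc, one_le_div (D.Q_pos hL)]
  exact D.Q_le_Q' L hL

theorem abs_div_Q_le (hL : L₀ ≤ L) (b : ℝ) : |b / D.Q L| ≤ K * |b| * Real.exp (-L) := by
  have hQL := D.Q_pos hL
  rw [abs_div, abs_of_pos hQL, div_le_iff₀ hQL, Real.exp_neg, mul_right_comm, ← div_eq_mul_inv,
    le_div_iff₀ (Real.exp_pos L), mul_right_comm, mul_comm]
  exact mul_le_mul_of_nonneg_right (D.exp_le_Q L hL) (abs_nonneg b)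

end Positivity

variable {f g : ℝ → ℝ} {L : ℝ}

theorem hasDerivAt_intQ (hf : Continuous f) (x : ℝ) :
    HasDerivAt (D.intQ f) (D.w⁻¹ * (D.Q x * f x)) x :=
  ((D.continuous_Q.mul hf).integral_hasStrictDerivAt 0 x).hasDerivAt.const_mul _

theorem hasDerivAt_intP (hf : Continuous f) (x : ℝ) :
    HasDerivAt (D.intP L f) (-(D.w⁻¹ * (D.P x * f x))) x := by
  have h := intervalIntegral.integral_hasDerivAt_left (a := x) (b := L)
    ((D.continuous_P.mul hf).intervalIntegrable _ _)
    (D.continuous_P.mul hf).aestronglyMeasurable.stronglyMeasurableAtFilter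
    (D.continuous_P.mul hf).continuousAt
  exact (h.const_mul D.w⁻¹).congr_deriv (mul_neg _ _)

theorem hasDerivAt_sol (hf : Continuous f) (a b x : ℝ) :
    HasDerivAt (D.sol L a b f) (D.solDeriv L a b f x) x := by
  refine ((((D.hasDerivAt_intQ hf x).const_add a).mul (D.hasDerivAt_P x)).add
    (((D.hasDerivAt_intP (L := L) hf x).const_add (b / D.Q L)).mul
      (D.hasDerivAt_Q x))).congr_deriv ?_
  rw [solDeriv]
  ring

theorem hasDerivAt_solDeriv (hf : Continuous f) (a b x : ℝ) :
    HasDerivAt (D.solDeriv L a b f) (D.q x * D.sol L a b f x - f x) x := by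
  refine ((((D.hasDerivAt_intQ hf x).const_add a).mul (D.hasDerivAt_P' x)).add
    (((D.hasDerivAt_intP (L := L) hf x).const_add (b / D.Q L)).mul
      (D.hasDerivAt_Q' x))).congr_deriv ?_
  have hw : D.w⁻¹ * (D.Q' x * D.P x - D.Q x * D.P' x) = 1 := by
    rw [D.wronskian, inv_mul_cancel₀ D.w_pos.ne']
  rw [sol]
  linear_combination (-f x) * hw

theorem continuous_sol (hf : Continuous f) (a b : ℝ) : Continuous (D.sol L a b f) :=
  continuous_iff_continuousAt.2 fun x => (D.hasDerivAt_sol hf a b x).continuousAt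

theorem intQ_sub (hf : Continuous f) (hg : Continuous g) (x : ℝ) :
    D.intQ (f - g) x = D.intQ f x - D.intQ g x := by
  simp only [intQ, Pi.sub_apply, mul_sub]
  rw [intervalIntegral.integral_sub ((D.continuous_Q.fun_mul hf).intervalIntegrable _ _)
    ((D.continuous_Q.fun_mul hg).intervalIntegrable _ _), mul_sub]

theorem intP_sub (hf : Continuous f) (hg : Continuous g) (x : ℝ) :
    D.intP L (f - g) x = D.intP L f x - D.intP L g x := by
  simp only [intP, Pi.sub_apply, mul_sub]
  rw [intervalIntegral.integral_sub ((D.continuous_P.fun_mul hf).intervalIntegrable _ _)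
    ((D.continuous_P.fun_mul hg).intervalIntegrable _ _), mul_sub]

theorem sol_sub (hf : Continuous f) (hg : Continuous g) (a b a' b' x : ℝ) :
    D.sol L (a - a') (b - b') (f - g) x = D.sol L a b f x - D.sol L a' b' g x := by
  simp only [sol, D.intQ_sub hf hg, D.intP_sub hf hg]
  ring

variable {M x : ℝ}

theorem abs_intQ_le (hf : ∀ y, |f y| ≤ M) (hx : 0 ≤ x) :
    |D.intQ f x| ≤ K ^ 2 * M * Real.exp x := by
  have hK := D.K_pos
  have hM : 0 ≤ M := (abs_nonneg _).trans (hf 0)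
  have hint : ‖∫ y in (0 : ℝ)..x, D.Q y * f y‖ ≤ ∫ y in (0 : ℝ)..x, K * M * Real.exp y := by
    refine intervalIntegral.norm_integral_le_of_norm_le hx (.of_forall fun y hy => ?_)
      ((continuous_const.mul Real.continuous_exp).intervalIntegrable _ _)
    rw [norm_mul, Real.norm_eq_abs, Real.norm_eq_abs, mul_right_comm]
    exact mul_le_mul (D.abs_Q_le y hy.1.le) (hf y) (abs_nonneg _) (by positivity)
  rw [intervalIntegral.integral_const_mul, integral_exp, Real.exp_zero] at hint
  calc |D.intQ f x| = D.w⁻¹ * |∫ y in (0 : ℝ)..x, D.Q y * f y| := by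
        rw [intQ, abs_mul, abs_of_pos (inv_pos.2 D.w_pos)]
    _ ≤ K * (K * M * (Real.exp x - 1)) := mul_le_mul D.inv_w_le hint (abs_nonneg _) hK.le
    _ ≤ K * (K * M * Real.exp x) := by gcongr; linarith
    _ = K ^ 2 * M * Real.exp x := by ring

theorem abs_intP_le (hf : ∀ y, |f y| ≤ M) (hx : x ∈ Icc 0 L) :
    |D.intP L f x| ≤ K ^ 2 * M * Real.exp (-x) := by
  have hK := D.K_pos
  have hM : 0 ≤ M := (abs_nonneg _).trans (hf 0)
  have hint : ‖∫ y in x..L, D.P y * f y‖ ≤ ∫ y in x..L, K * M * Real.exp (-y) := by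
    refine intervalIntegral.norm_integral_le_of_norm_le hx.2 (.of_forall fun y hy => ?_)
      ((continuous_const.mul (Real.continuous_exp.comp continuous_neg)).intervalIntegrable _ _)
    rw [norm_mul, Real.norm_eq_abs, Real.norm_eq_abs, mul_right_comm]
    exact mul_le_mul (D.abs_P_le y (hx.1.trans hy.1.le)) (hf y) (abs_nonneg _) (by positivity)
  rw [intervalIntegral.integral_const_mul, intervalIntegral.integral_comp_neg Real.exp,
    integral_exp] at hint
  calc |D.intP L f x| = D.w⁻¹ * |∫ y in x..L, D.P y * f y| := by
        rw [intP, abs_mul, abs_of_pos (inv_pos.2 D.w_pos)]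
    _ ≤ K * (K * M * (Real.exp (-x) - Real.exp (-L))) :=
        mul_le_mul D.inv_w_le hint (abs_nonneg _) hK.le
    _ ≤ K * (K * M * Real.exp (-x)) := by
        gcongr; exact sub_le_self _ (Real.exp_pos _).le
    _ = K ^ 2 * M * Real.exp (-x) := by ring

theorem abs_combination_le {u v : ℝ} (a b : ℝ) (hf : ∀ y, |f y| ≤ M) (hL : L₀ ≤ L)
    (hx : x ∈ Icc 0 L) (hu : |u| ≤ K * Real.exp (-x)) (hv : |v| ≤ K * Real.exp x) :
    |(a + D.intQ f x) * u + (b / D.Q L + D.intP L f x) * v| ≤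
      K * |a| + K ^ 2 * |b| + 2 * K ^ 3 * M := by
  have hK := D.K_pos
  have hexp : Real.exp x * Real.exp (-x) = 1 := by
    rw [← Real.exp_add, add_neg_cancel, Real.exp_zero]
  have hM : 0 ≤ M := (abs_nonneg _).trans (hf 0)
  have hexp_le : Real.exp (-x) ≤ 1 := Real.exp_le_one_iff.2 (neg_nonpos.2 hx.1)
  have hb : |b / D.Q L| ≤ K * |b| * Real.exp (-x) :=
    (D.abs_div_Q_le hL b).trans (by gcongr; exact hx.2)
  calc |(a + D.intQ f x) * u + (b / D.Q L + D.intP L f x) * v|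
      ≤ |a + D.intQ f x| * |u| + |b / D.Q L + D.intP L f x| * |v| :=
        (abs_add_le _ _).trans_eq (by rw [abs_mul, abs_mul])
    _ ≤ (|a| + K ^ 2 * M * Real.exp x) * (K * Real.exp (-x)) +
          (K * |b| * Real.exp (-x) + K ^ 2 * M * Real.exp (-x)) * (K * Real.exp x) := by
        have hcoefP : |a + D.intQ f x| ≤ |a| + K ^ 2 * M * Real.exp x :=
          (abs_add_le _ _).trans (add_le_add le_rfl (D.abs_intQ_le hf hx.1))
        have hcoefQ : |b / D.Q L + D.intP L f x| ≤
            K * |b| * Real.exp (-x) + K ^ 2 * M * Real.exp (-x) :=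
          (abs_add_le _ _).trans (add_le_add hb (D.abs_intP_le hf hx))
        gcongr
    _ = K * |a| * Real.exp (-x) +
          (K ^ 2 * |b| + 2 * K ^ 3 * M) * (Real.exp x * Real.exp (-x)) := by ring
    _ ≤ K * |a| * 1 + (K ^ 2 * |b| + 2 * K ^ 3 * M) * 1 := by rw [hexp]; gcongr
    _ = K * |a| + K ^ 2 * |b| + 2 * K ^ 3 * M := by ring

theorem abs_sol_le (a b : ℝ) (hf : ∀ y, |f y| ≤ M) (hL : L₀ ≤ L) (hx : x ∈ Icc 0 L) :
    |D.sol L a b f x| ≤ K * |a| + K ^ 2 * |b| + 2 * K ^ 3 * M :=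
  D.abs_combination_le a b hf hL hx (D.abs_P_le x hx.1) (D.abs_Q_le x hx.1)

theorem abs_solDeriv_le (a b : ℝ) (hf : ∀ y, |f y| ≤ M) (hL : L₀ ≤ L) (hx : x ∈ Icc 0 L) :
    |D.solDeriv L a b f x| ≤ K * |a| + K ^ 2 * |b| + 2 * K ^ 3 * M :=
  D.abs_combination_le a b hf hL hx (D.abs_P'_le x hx.1) (D.abs_Q'_le x hx.1)

end FundamentalSystem

/-! ### The linear transmission problem -/

/-- Boundary value data on the edges of a graph: the amplitudes `decay` and `grow` of the two
solutions of the linear equation, the source term, and offsets added to the value and to the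
outgoing slope at the final point of each edge. -/
structure EdgeData (E : Type*) where
  decay : E → ℝ
  grow : E → ℝ
  source : E → ℝ → ℝ
  offset : E → ℝ
  slopeOffset : E → ℝ

namespace EdgeData

variable {E : Type*}

instance : Sub (EdgeData E) where
  sub d d' :=
    { decay := d.decay - d'.decay
      grow := d.grow - d'.grow
      source := d.source - d'.source
      offset := d.offset - d'.offset
      slopeOffset := d.slopeOffset - d'.slopeOffset }

theorem decay_sub (d d' : EdgeData E) (e : E) : (d - d').decay e = d.decay e - d'.decay e := rfl

theorem grow_sub (d d' : EdgeData E) (e : E) : (d - d').grow e = d.grow e - d'.grow e := rfl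

theorem source_sub (d d' : EdgeData E) (e : E) : (d - d').source e = d.source e - d'.source e := rfl

theorem offset_sub (d d' : EdgeData E) (e : E) : (d - d').offset e = d.offset e - d'.offset e := rfl

theorem slopeOffset_sub (d d' : EdgeData E) (e : E) :
    (d - d').slopeOffset e = d.slopeOffset e - d'.slopeOffset e := rfl

/-- Bounds `A` for the amplitudes, `M` for the source and `O` for the offsets. -/
structure IsBounded (d : EdgeData E) (A M O : ℝ) : Prop where
  decay : ∀ e, |d.decay e| ≤ A
  grow : ∀ e, |d.grow e| ≤ A
  source : ∀ e x, |d.source e x| ≤ M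
  offset : ∀ e, |d.offset e| ≤ O
  slopeOffset : ∀ e, |d.slopeOffset e| ≤ O

end EdgeData

namespace MetricGraph

variable {V E : Type*} (G : MetricGraph V E) {K L₀ : ℝ} (D : E → FundamentalSystem K L₀)

/-- The solution of the linear equation on the edge `e` with the given amplitudes and source. -/
def edgeSol (d : EdgeData E) (e : E) : ℝ → ℝ :=
  (D e).sol (G.len e) (d.decay e) (d.grow e) (d.source e)

/-- The derivative of `edgeSol`. -/
def edgeSolDeriv (d : EdgeData E) (e : E) : ℝ → ℝ :=
  (D e).solDeriv (G.len e) (d.decay e) (d.grow e) (d.source e)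

/-- The amplitude of the growing solution at the initial point of `e`. -/
def srcAmp (d : EdgeData E) (e : E) : ℝ :=
  d.grow e / (D e).Q (G.len e) + (D e).intP (G.len e) (d.source e) 0

/-- The amplitude of the decaying solution at the final point of `e`. -/
def tgtAmp (d : EdgeData E) (e : E) : ℝ := d.decay e + (D e).intQ (d.source e) (G.len e)

/-- The value carried by the decaying solution to the final point of `e`, plus the offset. -/
def tgtVal (d : EdgeData E) (e : E) : ℝ :=
  G.tgtAmp D d e * (D e).P (G.len e) + d.offset e

/-- The outgoing slope carried by the decaying solution to the final point of `e`, plus the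
offset. -/
def tgtSlope (d : EdgeData E) (e : E) : ℝ :=
  -(G.tgtAmp D d e * (D e).P' (G.len e)) + d.slopeOffset e

section Vertex

variable [Fintype E]

open Classical in
/-- The coefficient of the vertex value in the Kirchhoff condition at `v`. -/
def vertexWeight (v : V) : ℝ :=
  (∑ e with G.src e = v, 1) + ∑ e with G.tgt e = v, (D e).slope (G.len e)

open Classical in
/-- The inhomogeneous term in the Kirchhoff condition at `v`. -/
def vertexSum (d : EdgeData E) (v : V) : ℝ :=
  (∑ e with G.src e = v, 2 * G.srcAmp D d e) +
    ∑ e with G.tgt e = v, ((D e).slope (G.len e) * G.tgtVal D d e + G.tgtSlope D d e)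

/-- The vertex value determined by the Kirchhoff condition. -/
def vertexVal (d : EdgeData E) (v : V) : ℝ := G.vertexSum D d v / G.vertexWeight D v

open Classical in
/-- The data with the same source and offsets whose amplitudes are those for which the value at
each edge end is the vertex value. At the initial point of `e₁`, where no vertex value is
prescribed, the decaying amplitude is set to `0`. -/
def balance (e₁ : E) (d : EdgeData E) : EdgeData E where
  __ := d
  decay e := if e = e₁ then 0 else G.vertexVal D d (G.src e) - G.srcAmp D d e
  grow e := G.vertexVal D d (G.tgt e) - G.tgtVal D d e

end Vertex

variable {G} {D} {d d' : EdgeData E}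

theorem continuous_edgeSol (hd : ∀ e, Continuous (d.source e)) (e : E) :
    Continuous (G.edgeSol D d e) :=
  (D e).continuous_sol (hd e) _ _

section Sub

variable (hd : ∀ e, Continuous (d.source e)) (hd' : ∀ e, Continuous (d'.source e))
include hd hd'

theorem edgeSol_sub (e : E) (x : ℝ) :
    G.edgeSol D (d - d') e x = G.edgeSol D d e x - G.edgeSol D d' e x :=
  (D e).sol_sub (hd e) (hd' e) _ _ _ _ x

theorem srcAmp_sub (e : E) : G.srcAmp D (d - d') e = G.srcAmp D d e - G.srcAmp D d' e := by
  simp only [srcAmp, EdgeData.source_sub, EdgeData.grow_sub, (D e).intP_sub (hd e) (hd' e)]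
  ring

theorem tgtAmp_sub (e : E) : G.tgtAmp D (d - d') e = G.tgtAmp D d e - G.tgtAmp D d' e := by
  simp only [tgtAmp, EdgeData.source_sub, EdgeData.decay_sub, (D e).intQ_sub (hd e) (hd' e)]
  ring

theorem tgtVal_sub (e : E) : G.tgtVal D (d - d') e = G.tgtVal D d e - G.tgtVal D d' e := by
  simp only [tgtVal, tgtAmp_sub hd hd', EdgeData.offset_sub]
  ring

theorem tgtSlope_sub (e : E) :
    G.tgtSlope D (d - d') e = G.tgtSlope D d e - G.tgtSlope D d' e := by
  simp only [tgtSlope, tgtAmp_sub hd hd', EdgeData.slopeOffset_sub]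
  ring

variable [Fintype E]

theorem vertexVal_sub (v : V) :
    G.vertexVal D (d - d') v = G.vertexVal D d v - G.vertexVal D d' v := by
  rw [vertexVal, vertexVal, vertexVal, ← sub_div]
  congr 1
  simp only [vertexSum, srcAmp_sub hd hd', tgtVal_sub hd hd', tgtSlope_sub hd hd', mul_sub,
    Finset.sum_sub_distrib, Finset.sum_add_distrib]
  ring

theorem balance_sub (e₁ : E) :
    G.balance D e₁ (d - d') = G.balance D e₁ d - G.balance D e₁ d' := by
  change EdgeData.mk _ _ _ _ _ = EdgeData.mk _ _ _ _ _
  congr 1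
  · funext e
    simp only [balance, Pi.sub_apply, vertexVal_sub hd hd', srcAmp_sub hd hd']
    split_ifs <;> ring
  · funext e
    simp only [balance, Pi.sub_apply, vertexVal_sub hd hd', tgtVal_sub hd hd']
    ring

end Sub

section Bounds

variable {A M O ℓ m : ℝ}

theorem abs_srcAmp_le (hK : 1 ≤ K) (hℓ : ∀ e, ℓ ≤ G.len e) (hL : ∀ e, L₀ ≤ G.len e)
    (hd : d.IsBounded A M O) (e : E) :
    |G.srcAmp D d e| ≤ K * A * Real.exp (-ℓ) + K ^ 3 * M := by
  have hM : 0 ≤ M := (abs_nonneg _).trans (hd.source e 0)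
  have hA : 0 ≤ A := (abs_nonneg _).trans (hd.grow e)
  refine (abs_add_le _ _).trans (add_le_add ?_ ?_)
  · refine ((D e).abs_div_Q_le (hL e) _).trans ?_
    gcongr
    · exact hd.grow e
    · exact hℓ e
  · refine ((D e).abs_intP_le (hd.source e) ⟨le_rfl, (G.len_pos e).le⟩).trans ?_
    rw [neg_zero, Real.exp_zero, mul_one]
    have hK' : K ^ 2 ≤ K ^ 3 := pow_le_pow_right₀ hK (by norm_num)
    gcongr

theorem abs_tgtAmp_mul_le (hK : 1 ≤ K) (hℓ : ∀ e, ℓ ≤ G.len e) (hd : d.IsBounded A M O) (e : E)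
    {u : ℝ} (hu : |u| ≤ K * Real.exp (-G.len e)) :
    |G.tgtAmp D d e * u| ≤ K * A * Real.exp (-ℓ) + K ^ 3 * M := by
  have hM : 0 ≤ M := (abs_nonneg _).trans (hd.source e 0)
  have hA : 0 ≤ A := (abs_nonneg _).trans (hd.decay e)
  have hexp : Real.exp (G.len e) * Real.exp (-G.len e) = 1 := by
    rw [← Real.exp_add, add_neg_cancel, Real.exp_zero]
  have hamp : |G.tgtAmp D d e| ≤ A + K ^ 2 * M * Real.exp (G.len e) :=
    (abs_add_le _ _).trans
      (add_le_add (hd.decay e) ((D e).abs_intQ_le (hd.source e) (G.len_pos e).le))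
  rw [abs_mul]
  calc |G.tgtAmp D d e| * |u|
      ≤ (A + K ^ 2 * M * Real.exp (G.len e)) * (K * Real.exp (-G.len e)) := by gcongr
    _ = K * A * Real.exp (-G.len e) +
          K ^ 3 * M * (Real.exp (G.len e) * Real.exp (-G.len e)) := by ring
    _ ≤ K * A * Real.exp (-ℓ) + K ^ 3 * M := by
        rw [hexp, mul_one]; gcongr; exact hℓ e

theorem abs_tgtVal_le (hK : 1 ≤ K) (hℓ : ∀ e, ℓ ≤ G.len e) (hd : d.IsBounded A M O) (e : E) :
    |G.tgtVal D d e| ≤ K * A * Real.exp (-ℓ) + K ^ 3 * M + O :=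
  (abs_add_le _ _).trans (add_le_add
    (abs_tgtAmp_mul_le hK hℓ hd e ((D e).abs_P_le _ (G.len_pos e).le)) (hd.offset e))

theorem abs_tgtSlope_le (hK : 1 ≤ K) (hℓ : ∀ e, ℓ ≤ G.len e) (hd : d.IsBounded A M O) (e : E) :
    |G.tgtSlope D d e| ≤ K * A * Real.exp (-ℓ) + K ^ 3 * M + O := by
  refine (abs_add_le _ _).trans (add_le_add ?_ (hd.slopeOffset e))
  rw [abs_neg]
  exact abs_tgtAmp_mul_le hK hℓ hd e ((D e).abs_P'_le _ (G.len_pos e).le)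

variable [Fintype E]

theorem vertexWeight_nonneg (hL : ∀ e, L₀ ≤ G.len e) (v : V) : 0 ≤ G.vertexWeight D v :=
  add_nonneg (Finset.sum_nonneg fun _ _ => zero_le_one)
    (Finset.sum_nonneg fun e _ => ((D e).slope_pos (hL e)).le)

variable (hK : 1 ≤ K) (hℓ : ∀ e, ℓ ≤ G.len e) (hL : ∀ e, L₀ ≤ G.len e) (hd : d.IsBounded A M O)
  (hm : K * A * Real.exp (-ℓ) + K ^ 3 * M + O ≤ m)
include hK hℓ hL hd hm

theorem abs_vertexSum_le (v : V) :
    |G.vertexSum D d v| ≤ (K + 1) * m * G.vertexWeight D v := by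
  rw [vertexSum, vertexWeight, mul_add, Finset.mul_sum, Finset.mul_sum]
  refine (abs_add_le _ _).trans (add_le_add
    ((Finset.abs_sum_le_sum_abs _ _).trans (Finset.sum_le_sum fun e _ => ?_))
    ((Finset.abs_sum_le_sum_abs _ _).trans (Finset.sum_le_sum fun e _ => ?_)))
  · have hO : 0 ≤ O := (abs_nonneg _).trans (hd.offset e)
    have hsrc : |G.srcAmp D d e| ≤ m := (abs_srcAmp_le hK hℓ hL hd e).trans (by linarith)
    rw [abs_mul, abs_two, mul_one]
    exact mul_le_mul (by linarith) hsrc (abs_nonneg _) (by linarith)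
  · have hval : |G.tgtVal D d e| ≤ m := (abs_tgtVal_le hK hℓ hd e).trans hm
    have hslope : |G.tgtSlope D d e| ≤ m := (abs_tgtSlope_le hK hℓ hd e).trans hm
    have hm0 : 0 ≤ m := (abs_nonneg _).trans hval
    have hpos := (D e).slope_pos (hL e)
    calc |(D e).slope (G.len e) * G.tgtVal D d e + G.tgtSlope D d e|
        ≤ (D e).slope (G.len e) * |G.tgtVal D d e| + |G.tgtSlope D d e| :=
          (abs_add_le _ _).trans_eq (by rw [abs_mul, abs_of_pos hpos])
      _ ≤ (D e).slope (G.len e) * m + K * (D e).slope (G.len e) * m := by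
          gcongr
          exact hslope.trans (le_mul_of_one_le_left hm0 ((D e).one_le_mul_slope (hL e)))
      _ = (K + 1) * m * (D e).slope (G.len e) := by ring

theorem abs_vertexVal_le (hm0 : 0 ≤ m) (v : V) : |G.vertexVal D d v| ≤ (K + 1) * m := by
  rw [vertexVal, abs_div, abs_of_nonneg (vertexWeight_nonneg hL v)]
  exact div_le_of_le_mul₀ (vertexWeight_nonneg hL v) (by positivity)
    (abs_vertexSum_le hK hℓ hL hd hm v)

theorem abs_balance_decay_le (e₁ e : E) : |(G.balance D e₁ d).decay e| ≤ 3 * K * m := by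
  have hm0 : 0 ≤ m := (abs_nonneg _).trans ((abs_tgtVal_le (D := D) hK hℓ hd e).trans hm)
  have hval := abs_vertexVal_le (D := D) hK hℓ hL hd hm hm0 (G.src e)
  have hO : 0 ≤ O := (abs_nonneg _).trans (hd.offset e)
  have hamp := abs_srcAmp_le (D := D) hK hℓ hL hd e
  have hmK : m ≤ K * m := le_mul_of_one_le_left hm0 hK
  simp only [balance]
  split_ifs
  · rw [abs_zero]; positivity
  · exact (abs_sub _ _).trans (by linarith)

theorem abs_balance_grow_le (e₁ e : E) : |(G.balance D e₁ d).grow e| ≤ 3 * K * m := by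
  have htgt := (abs_tgtVal_le (D := D) hK hℓ hd e).trans hm
  have hm0 : 0 ≤ m := (abs_nonneg _).trans htgt
  have hval := abs_vertexVal_le (D := D) hK hℓ hL hd hm hm0 (G.tgt e)
  have hmK : m ≤ K * m := le_mul_of_one_le_left hm0 hK
  exact (abs_sub _ _).trans (by linarith)

theorem abs_edgeSol_balance_le (e₁ e : E) {x : ℝ} (hx : x ∈ Icc 0 (G.len e)) :
    |G.edgeSol D (G.balance D e₁ d) e x| ≤ 8 * K ^ 3 * m := by
  have hA : 0 ≤ A := (abs_nonneg _).trans (hd.decay e)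
  have hO : 0 ≤ O := (abs_nonneg _).trans (hd.offset e)
  have hm0 : 0 ≤ m := (abs_nonneg _).trans ((abs_tgtVal_le (D := D) hK hℓ hd e).trans hm)
  have hsource : K ^ 3 * M ≤ m := by
    have : 0 ≤ K * A * Real.exp (-ℓ) := by positivity
    linarith
  have h23 : K ^ 2 ≤ K ^ 3 := pow_le_pow_right₀ hK (by norm_num)
  have h13 : 1 ≤ K ^ 3 := one_le_pow₀ hK
  calc |G.edgeSol D (G.balance D e₁ d) e x|
      ≤ K * |(G.balance D e₁ d).decay e| + K ^ 2 * |(G.balance D e₁ d).grow e| +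
          2 * K ^ 3 * M := (D e).abs_sol_le _ _ (hd.source e) (hL e) hx
    _ ≤ K * (3 * K * m) + K ^ 2 * (3 * K * m) + 2 * m := by
        have hdecay := abs_balance_decay_le (D := D) hK hℓ hL hd hm e₁ e
        have hgrow := abs_balance_grow_le (D := D) hK hℓ hL hd hm e₁ e
        gcongr ?_ + ?_ + ?_
        · gcongr
        · gcongr
        · linarith
    _ = 3 * (K ^ 2 * m) + 3 * (K ^ 3 * m) + 2 * (1 * m) := by ring
    _ ≤ 3 * (K ^ 3 * m) + 3 * (K ^ 3 * m) + 2 * (K ^ 3 * m) := by gcongr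
    _ = 8 * K ^ 3 * m := by ring

end Bounds

section Balanced

variable [Fintype E] {e₁ e : E} (hd : G.balance D e₁ d = d)

theorem vertexVal_mul_vertexWeight (hL : ∀ e, L₀ ≤ G.len e) (v : V) :
    G.vertexVal D d v * G.vertexWeight D v = G.vertexSum D d v := by
  refine div_mul_cancel_of_imp fun hweight => ?_
  have hslope : ∀ e, 0 < (D e).slope (G.len e) := fun e => (D e).slope_pos (hL e)
  have hsum := (add_eq_zero_iff_of_nonneg (Finset.sum_nonneg fun _ _ => zero_le_one)
    (Finset.sum_nonneg fun e _ => (hslope e).le)).1 hweight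
  rw [vertexSum, Finset.sum_eq_zero, Finset.sum_eq_zero, add_zero]
  · intro e he
    exact absurd ((Finset.sum_eq_zero_iff_of_nonneg fun e _ => (hslope e).le).1 hsum.2 e he)
      (hslope e).ne'
  · intro e he
    exact absurd ((Finset.sum_eq_zero_iff_of_nonneg fun _ _ => zero_le_one).1 hsum.1 e he)
      one_ne_zero

include hd

theorem decay_eq_of_balance_eq (he : e ≠ e₁) :
    d.decay e = G.vertexVal D d (G.src e) - G.srcAmp D d e :=
  (congrArg (fun d : EdgeData E => d.decay e) hd.symm).trans (if_neg he)

theorem decay_eq_zero_of_balance_eq : d.decay e₁ = 0 :=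
  (congrArg (fun d : EdgeData E => d.decay e₁) hd.symm).trans (if_pos rfl)

theorem grow_eq_of_balance_eq (e : E) :
    d.grow e = G.vertexVal D d (G.tgt e) - G.tgtVal D d e :=
  congrArg (fun d : EdgeData E => d.grow e) hd.symm

theorem edgeSol_zero_of_balance_eq (he : e ≠ e₁) (hP : (D e).P 0 = 1) (hQ : (D e).Q 0 = 1) :
    G.edgeSol D d e 0 = G.vertexVal D d (G.src e) := by
  rw [edgeSol, FundamentalSystem.sol, FundamentalSystem.intQ, intervalIntegral.integral_same,
    hP, hQ, decay_eq_of_balance_eq hd he, srcAmp]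
  ring

theorem edgeSolDeriv_zero_of_balance_eq (he : e ≠ e₁) (hP : (D e).P' 0 = -1)
    (hQ : (D e).Q' 0 = 1) :
    G.edgeSolDeriv D d e 0 = 2 * G.srcAmp D d e - G.vertexVal D d (G.src e) := by
  rw [edgeSolDeriv, FundamentalSystem.solDeriv, FundamentalSystem.intQ,
    intervalIntegral.integral_same, hP, hQ, decay_eq_of_balance_eq hd he, srcAmp]
  ring

theorem edgeSolDeriv_zero_pendant_of_balance_eq (hQ : (D e₁).Q' 0 = 0) :
    G.edgeSolDeriv D d e₁ 0 = 0 := by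
  rw [edgeSolDeriv, FundamentalSystem.solDeriv, FundamentalSystem.intQ,
    intervalIntegral.integral_same, hQ, decay_eq_zero_of_balance_eq hd]
  ring

theorem edgeSol_len_of_balance_eq (hL : L₀ ≤ G.len e) :
    G.edgeSol D d e (G.len e) + d.offset e = G.vertexVal D d (G.tgt e) := by
  rw [edgeSol, FundamentalSystem.sol, FundamentalSystem.intP, intervalIntegral.integral_same,
    mul_zero, add_zero, div_mul_cancel₀ _ ((D e).Q_pos hL).ne', grow_eq_of_balance_eq hd, tgtVal,
    tgtAmp]
  ring

theorem edgeSolDeriv_len_of_balance_eq (e : E) :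
    -G.edgeSolDeriv D d e (G.len e) + d.slopeOffset e =
      ((D e).slope (G.len e) * G.tgtVal D d e + G.tgtSlope D d e) -
        G.vertexVal D d (G.tgt e) * (D e).slope (G.len e) := by
  have hgrow : d.grow e / (D e).Q (G.len e) * (D e).Q' (G.len e) =
      d.grow e * (D e).slope (G.len e) := by
    rw [FundamentalSystem.slope]; ring
  rw [edgeSolDeriv, FundamentalSystem.solDeriv, FundamentalSystem.intP,
    intervalIntegral.integral_same, mul_zero, add_zero, hgrow, grow_eq_of_balance_eq hd, tgtSlope,
    tgtAmp]
  ring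

open Classical in
theorem kirchhoff_of_balance_eq (hL : ∀ e, L₀ ≤ G.len e) {v : V} (hv : v ≠ G.src e₁)
    (hP : ∀ e, e ≠ e₁ → (D e).P' 0 = -1) (hQ : ∀ e, e ≠ e₁ → (D e).Q' 0 = 1) :
    (∑ e with G.src e = v, G.edgeSolDeriv D d e 0) +
      ∑ e with G.tgt e = v, (-G.edgeSolDeriv D d e (G.len e) + d.slopeOffset e) = 0 := by
  have hsrc : ∑ e with G.src e = v, G.edgeSolDeriv D d e 0 =
      ∑ e with G.src e = v, (2 * G.srcAmp D d e - G.vertexVal D d v * 1) := by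
    refine Finset.sum_congr rfl fun e he => ?_
    have hev : G.src e = v := (Finset.mem_filter.1 he).2
    have hne : e ≠ e₁ := fun h => hv (by rw [← hev, h])
    rw [edgeSolDeriv_zero_of_balance_eq hd hne (hP e hne) (hQ e hne), hev, mul_one]
  have htgt : ∑ e with G.tgt e = v, (-G.edgeSolDeriv D d e (G.len e) + d.slopeOffset e) =
      ∑ e with G.tgt e = v, (((D e).slope (G.len e) * G.tgtVal D d e + G.tgtSlope D d e) -
        G.vertexVal D d v * (D e).slope (G.len e)) := by
    refine Finset.sum_congr rfl fun e he => ?_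
    rw [edgeSolDeriv_len_of_balance_eq hd, (Finset.mem_filter.1 he).2]
  have hval := vertexVal_mul_vertexWeight (D := D) (d := d) hL v
  rw [vertexWeight, vertexSum, mul_add, Finset.mul_sum, Finset.mul_sum] at hval
  rw [hsrc, htgt, Finset.sum_sub_distrib, Finset.sum_sub_distrib]
  linarith

end Balanced

end MetricGraph

/-! ### The contraction mapping -/

/-- A continuous function `f x t` that vanishes at `t = 0` and is Lipschitz in `t` with
constant `ε`. -/
structure LipschitzTerm (ε : ℝ) where
  toFun : ℝ → ℝ → ℝ
  continuous_uncurry : Continuous (Function.uncurry toFun)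
  map_zero : ∀ x, toFun x 0 = 0
  abs_sub_le : ∀ x s t, |toFun x s - toFun x t| ≤ ε * |s - t|

theorem LipschitzTerm.abs_le {ε : ℝ} (N : LipschitzTerm ε) (x t : ℝ) :
    |N.toFun x t| ≤ ε * |t| := by
  simpa only [N.map_zero, sub_zero] using N.abs_sub_le x t 0

namespace MetricGraph

section TransmissionMap

variable {V E : Type*} (G : MetricGraph V E) {K L₀ ε : ℝ}
  (D : E → FundamentalSystem K L₀) (N : E → LipschitzTerm ε) (e₁ : E) (o o' : E → ℝ)

/-- The state space of the contraction mapping: the two amplitudes and the values of the solution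
on each edge. -/
abbrev TransmissionState : Type _ := (E → ℝ) × (E → ℝ) × (∀ e, C(Icc 0 (G.len e), ℝ))

/-- The edge data with source `N` evaluated along the state `z`. -/
def stateData (z : G.TransmissionState) : EdgeData E where
  decay := z.1
  grow := z.2.1
  source e x := (N e).toFun x (IccExtend (G.len_pos e).le (z.2.2 e) x)
  offset := o
  slopeOffset := o'

theorem continuous_stateData_source (z : G.TransmissionState) (e : E) :
    Continuous ((G.stateData N o o' z).source e) :=
  (N e).continuous_uncurry.comp (continuous_id.prodMk (z.2.2 e).continuous.Icc_extend')

variable {G N o o'} in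
theorem isBounded_stateData_zero {O : ℝ} (ho : ∀ e, |o e| ≤ O) (ho' : ∀ e, |o' e| ≤ O) :
    (G.stateData N o o' 0).IsBounded 0 0 O where
  decay e := abs_zero.le
  grow e := abs_zero.le
  source e x := by
    change |(N e).toFun x 0| ≤ 0
    rw [(N e).map_zero, abs_zero]
  offset := ho
  slopeOffset := ho'

variable [Fintype E]

theorem continuous_balance_stateData_source (z : G.TransmissionState) (e : E) :
    Continuous ((G.balance D e₁ (G.stateData N o o' z)).source e) :=
  G.continuous_stateData_source N o o' z e

/-- The map whose fixed points solve the nonlinear transmission problem. -/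
def transmissionMap (z : G.TransmissionState) : G.TransmissionState :=
  ((G.balance D e₁ (G.stateData N o o' z)).decay, (G.balance D e₁ (G.stateData N o o' z)).grow,
    fun e => ⟨fun x => G.edgeSol D (G.balance D e₁ (G.stateData N o o' z)) e x,
      (continuous_edgeSol (G.continuous_balance_stateData_source D N e₁ o o' z) e).comp
        continuous_subtype_val⟩)

variable {G} in
theorem norm_transmissionState_value_le {z : G.TransmissionState} {r : ℝ} (hz : ‖z‖ ≤ r)
    (e : E) : ‖z.2.2 e‖ ≤ r :=
  (norm_le_pi_norm z.2.2 e).trans ((norm_snd_le z.2).trans ((norm_snd_le z).trans hz))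

variable {G} in
theorem dist_transmissionState_le {z w : G.TransmissionState} {r : ℝ} (hr : 0 ≤ r)
    (hdecay : ∀ e, |z.1 e - w.1 e| ≤ r) (hgrow : ∀ e, |z.2.1 e - w.2.1 e| ≤ r)
    (hsol : ∀ e x, |z.2.2 e x - w.2.2 e x| ≤ r) : dist z w ≤ r :=
  max_le ((dist_pi_le_iff hr).2 hdecay) (max_le ((dist_pi_le_iff hr).2 hgrow)
    ((dist_pi_le_iff hr).2 fun e => (ContinuousMap.dist_le hr).2 (hsol e)))

variable {G D N e₁ o o'}

theorem isBounded_stateData_sub (hε : 0 ≤ ε) (z w : G.TransmissionState) :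
    (G.stateData N o o' z - G.stateData N o o' w).IsBounded (dist z w) (ε * dist z w) 0 where
  decay e := (dist_le_pi_dist z.1 w.1 e).trans (le_max_left _ _)
  grow e := (dist_le_pi_dist z.2.1 w.2.1 e).trans ((le_max_left _ _).trans (le_max_right _ _))
  source e x := ((N e).abs_sub_le x _ _).trans (mul_le_mul_of_nonneg_left
    (((ContinuousMap.dist_apply_le_dist _).trans (dist_le_pi_dist z.2.2 w.2.2 e)).trans
      ((le_max_right _ _).trans (le_max_right _ _))) hε)
  offset e := by rw [EdgeData.offset_sub, stateData, stateData, sub_self, abs_zero]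
  slopeOffset e := by rw [EdgeData.slopeOffset_sub, stateData, stateData, sub_self, abs_zero]

section FixedPoint

variable {z : G.TransmissionState} (hz : G.transmissionMap D N e₁ o o' z = z)
include hz

theorem balance_stateData_of_transmissionMap_eq :
    G.balance D e₁ (G.stateData N o o' z) = G.stateData N o o' z := by
  change EdgeData.mk _ _ _ _ _ = EdgeData.mk _ _ _ _ _
  congr 1
  · exact congrArg Prod.fst hz
  · exact congrArg (fun y : G.TransmissionState => y.2.1) hz

theorem edgeSol_stateData_of_transmissionMap_eq (e : E) (x : Icc 0 (G.len e)) :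
    G.edgeSol D (G.stateData N o o' z) e x = z.2.2 e x := by
  have hvalue := DFunLike.congr_fun
    (congrFun (congrArg (fun y : G.TransmissionState => y.2.2) hz) e) x
  rwa [transmissionMap, ContinuousMap.coe_mk, balance_stateData_of_transmissionMap_eq hz]
    at hvalue

end FixedPoint

section Estimates

variable {ℓ : ℝ} (hK : 1 ≤ K) (hℓ : ∀ e, ℓ ≤ G.len e) (hL : ∀ e, L₀ ≤ G.len e)
include hK hℓ hL

theorem dist_transmissionMap_le (hε : 0 ≤ ε) (hsmall : 16 * K ^ 6 * (Real.exp (-ℓ) + ε) ≤ 1)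
    (z w : G.TransmissionState) :
    dist (G.transmissionMap D N e₁ o o' z) (G.transmissionMap D N e₁ o o' w) ≤
      1 / 2 * dist z w := by
  have hz := G.continuous_stateData_source N o o' z
  have hw := G.continuous_stateData_source N o o' w
  have hd := isBounded_stateData_sub (N := N) (o := o) (o' := o') hε z w
  have hm : K * dist z w * Real.exp (-ℓ) + K ^ 3 * (ε * dist z w) + 0 ≤
      K ^ 3 * (Real.exp (-ℓ) + ε) * dist z w := by
    have hK' : K ≤ K ^ 3 := le_self_pow₀ hK (by norm_num)
    calc K * dist z w * Real.exp (-ℓ) + K ^ 3 * (ε * dist z w) + 0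
        ≤ K ^ 3 * dist z w * Real.exp (-ℓ) + K ^ 3 * (ε * dist z w) + 0 := by gcongr
      _ = K ^ 3 * (Real.exp (-ℓ) + ε) * dist z w := by ring
  have hsol : 8 * K ^ 3 * (K ^ 3 * (Real.exp (-ℓ) + ε) * dist z w) ≤ 1 / 2 * dist z w := by
    have := mul_le_mul_of_nonneg_right hsmall (dist_nonneg (x := z) (y := w))
    linarith
  have hamp : 3 * K * (K ^ 3 * (Real.exp (-ℓ) + ε) * dist z w) ≤ 1 / 2 * dist z w := by
    refine le_trans ?_ hsol
    have hK' : K ≤ K ^ 3 := le_self_pow₀ hK (by norm_num)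
    gcongr
    norm_num
  have hbalance := balance_sub (G := G) (D := D) hz hw e₁
  refine dist_transmissionState_le (by positivity) (fun e => ?_) (fun e => ?_) (fun e x => ?_)
  · have := abs_balance_decay_le (D := D) hK hℓ hL hd hm e₁ e
    rw [hbalance] at this
    exact this.trans hamp
  · have := abs_balance_grow_le (D := D) hK hℓ hL hd hm e₁ e
    rw [hbalance] at this
    exact this.trans hamp
  · have := abs_edgeSol_balance_le (D := D) hK hℓ hL hd hm e₁ e x.2
    rw [hbalance, edgeSol_sub (G.continuous_balance_stateData_source D N e₁ o o' z)
      (G.continuous_balance_stateData_source D N e₁ o o' w)] at this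
    exact this.trans hsol

theorem dist_zero_transmissionMap_zero_le {O : ℝ} (hO : 0 ≤ O) (ho : ∀ e, |o e| ≤ O)
    (ho' : ∀ e, |o' e| ≤ O) : dist 0 (G.transmissionMap D N e₁ o o' 0) ≤ 8 * K ^ 3 * O := by
  have hd := isBounded_stateData_zero (G := G) (N := N) ho ho'
  have hm : K * 0 * Real.exp (-ℓ) + K ^ 3 * 0 + O ≤ O := by simp
  have hamp : 3 * K * O ≤ 8 * K ^ 3 * O := by
    have hK' : K ≤ K ^ 3 := le_self_pow₀ hK (by norm_num)
    gcongr
    norm_num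
  rw [dist_comm]
  refine dist_transmissionState_le (by positivity) (fun e => ?_) (fun e => ?_) (fun e x => ?_)
  · exact (congrArg abs (sub_zero _)).trans_le
      ((abs_balance_decay_le (D := D) hK hℓ hL hd hm e₁ e).trans hamp)
  · exact (congrArg abs (sub_zero _)).trans_le
      ((abs_balance_grow_le (D := D) hK hℓ hL hd hm e₁ e).trans hamp)
  · exact (congrArg abs (sub_zero _)).trans_le
      (abs_edgeSol_balance_le (D := D) hK hℓ hL hd hm e₁ e x.2)

theorem exists_transmissionMap_eq (hε : 0 ≤ ε) (hsmall : 16 * K ^ 6 * (Real.exp (-ℓ) + ε) ≤ 1)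
    {O : ℝ} (hO : 0 ≤ O) (ho : ∀ e, |o e| ≤ O) (ho' : ∀ e, |o' e| ≤ O) :
    ∃ z : G.TransmissionState, G.transmissionMap D N e₁ o o' z = z ∧ ‖z‖ ≤ 16 * K ^ 3 * O := by
  have hT : ContractingWith (1 / 2) (G.transmissionMap D N e₁ o o') :=
    ⟨by rw [← NNReal.coe_lt_coe]; norm_num, LipschitzWith.of_dist_le_mul fun z w => by
      simpa using dist_transmissionMap_le hK hℓ hL hε hsmall z w⟩
  refine ⟨hT.fixedPoint, hT.fixedPoint_isFixedPt, ?_⟩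
  have hdist := hT.dist_fixedPoint_le 0
  have hhalf : (1 : ℝ) - ((1 / 2 : NNReal) : ℝ) = 1 / 2 := by norm_num
  rw [hhalf, le_div_iff₀ one_half_pos, dist_zero_left] at hdist
  have hzero := dist_zero_transmissionMap_zero_le (G := G) (D := D) (N := N) (e₁ := e₁)
    hK hℓ hL hO ho ho'
  linarith

omit hℓ in
theorem abs_edgeSolDeriv_stateData_le (hε : 0 ≤ ε) (hKε : 2 * K * ε ≤ 1) {r : ℝ}
    {z : G.TransmissionState} (hz : ‖z‖ ≤ r) (e : E) {x : ℝ} (hx : x ∈ Icc 0 (G.len e)) :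
    |G.edgeSolDeriv D (G.stateData N o o' z) e x| ≤ 3 * K ^ 2 * r := by
  have hr : 0 ≤ r := (norm_nonneg z).trans hz
  have hdecay : |z.1 e| ≤ r := (norm_le_pi_norm z.1 e).trans ((norm_fst_le z).trans hz)
  have hgrow : |z.2.1 e| ≤ r :=
    (norm_le_pi_norm z.2.1 e).trans ((norm_fst_le z.2).trans ((norm_snd_le z).trans hz))
  have hsource : ∀ y, |(G.stateData N o o' z).source e y| ≤ ε * r := fun y =>
    ((N e).abs_le y _).trans (mul_le_mul_of_nonneg_left
      (((z.2.2 e).norm_coe_le_norm _).trans (norm_transmissionState_value_le hz e)) hε)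
  calc |G.edgeSolDeriv D (G.stateData N o o' z) e x|
      ≤ K * |z.1 e| + K ^ 2 * |z.2.1 e| + 2 * K ^ 3 * (ε * r) :=
        (D e).abs_solDeriv_le _ _ hsource (hL e) hx
    _ = K * |z.1 e| + K ^ 2 * |z.2.1 e| + K ^ 2 * (2 * K * ε) * r := by ring
    _ ≤ K ^ 2 * r + K ^ 2 * r + K ^ 2 * 1 * r := by
        have hK' : K ≤ K ^ 2 := le_self_pow₀ hK two_ne_zero
        gcongr
    _ = 3 * K ^ 2 * r := by ring

theorem exists_small_transmission_solution (hε : 0 ≤ ε)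
    (hsmall : 16 * K ^ 6 * (Real.exp (-ℓ) + ε) ≤ 1)
    {O : ℝ} (hO : 0 ≤ O) (ho : ∀ e, |o e| ≤ O) (ho' : ∀ e, |o' e| ≤ O) :
    ∃ d : EdgeData E, d.offset = o ∧ d.slopeOffset = o' ∧ (∀ e, Continuous (d.source e)) ∧
      G.balance D e₁ d = d ∧ ∀ e, ∀ x ∈ Icc 0 (G.len e),
        d.source e x = (N e).toFun x (G.edgeSol D d e x) ∧
        |G.edgeSol D d e x| ≤ 16 * K ^ 3 * O ∧ |G.edgeSolDeriv D d e x| ≤ 48 * K ^ 5 * O := by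
  obtain ⟨z, hz, hnorm⟩ := exists_transmissionMap_eq (G := G) (D := D) (N := N) (e₁ := e₁)
    hK hℓ hL hε hsmall hO ho ho'
  have hKε : 2 * K * ε ≤ 1 := by
    have hexp : 0 ≤ K ^ 6 * Real.exp (-ℓ) := by positivity
    have hKK : K * ε ≤ K ^ 6 * ε :=
      mul_le_mul_of_nonneg_right (le_self_pow₀ hK (by norm_num)) hε
    linarith [show 0 ≤ K ^ 6 * ε by positivity]
  refine ⟨G.stateData N o o' z, rfl, rfl, G.continuous_stateData_source N o o' z,
    balance_stateData_of_transmissionMap_eq hz, fun e x hx => ?_⟩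
  have hsol := edgeSol_stateData_of_transmissionMap_eq hz e ⟨x, hx⟩
  refine ⟨congrArg ((N e).toFun x) ((IccExtend_of_mem _ _ hx).trans hsol.symm), ?_,
    (abs_edgeSolDeriv_stateData_le hK hL hε hKε hnorm e hx).trans_eq (by ring)⟩
  exact (congrArg abs hsol).trans_le
    (((z.2.2 e).norm_coe_le_norm _).trans (norm_transmissionState_value_le hnorm e))

end Estimates

end TransmissionMap

end MetricGraph

/-! ### Solutions near the soliton on a graph with long edges -/

theorem exists_lipschitzTerm_eq_powRemainder {p : ℝ} (hp : 1 < p) (A : ℝ) {ε : ℝ} (hε : 0 < ε) :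
    ∃ δ > 0, ∀ U : ℝ → ℝ, Continuous U → (∀ x, U x ∈ Icc 0 A) →
      ∃ N : LipschitzTerm ε, ∀ x t, |t| ≤ δ → N.toFun x t = powRemainder p (U x) t := by
  obtain ⟨δ, hδ, hLip⟩ := exists_powRemainder_lipschitz hp A hε
  have hδ' : -δ ≤ δ := neg_le_self hδ.le
  refine ⟨δ, hδ, fun U hU hmem => ⟨{
    toFun := fun x t => powRemainder p (U x) (projIcc (-δ) δ hδ' t)
    continuous_uncurry := continuous_powRemainder hp (hU.comp continuous_fst)
      (continuous_subtype_val.comp (continuous_projIcc.comp continuous_snd))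
    map_zero := fun x => by
      rw [projIcc_of_mem hδ' ⟨by linarith, hδ.le⟩, powRemainder_zero p (hmem x).1]
    abs_sub_le := fun x s t => (hLip _ (hmem x) _ (projIcc _ _ hδ' s).2 _
      (projIcc _ _ hδ' t).2).trans
        (mul_le_mul_of_nonneg_left (abs_projIcc_sub_projIcc hδ') hε.le) }, fun x t ht => ?_⟩⟩
  exact congrArg (fun y : Icc (-δ) δ => powRemainder p (U x) y) (projIcc_of_mem hδ' (abs_le.1 ht))

namespace MetricGraph

section SolitonOn

variable {E : Type*}

open Classical in
/-- The soliton on the edge `e₁`, extended by `0` to the other edges. -/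
def solitonOn (p : ℝ) (e₁ e : E) (x : ℝ) : ℝ := if e = e₁ then soliton p x else 0

open Classical in
/-- The derivative of `solitonOn`. -/
def solitonOnDeriv (p : ℝ) (e₁ e : E) (x : ℝ) : ℝ := if e = e₁ then solitonDeriv p x else 0

variable {p : ℝ} {e₁ e : E}

theorem solitonOn_self (p : ℝ) (e₁ : E) : solitonOn p e₁ e₁ = soliton p :=
  funext fun _ => if_pos rfl

theorem solitonOn_of_ne (p : ℝ) (he : e ≠ e₁) : solitonOn p e₁ e = 0 :=
  funext fun _ => if_neg he

theorem solitonOnDeriv_self (p : ℝ) (e₁ : E) : solitonOnDeriv p e₁ e₁ = solitonDeriv p :=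
  funext fun _ => if_pos rfl

theorem solitonOnDeriv_of_ne (p : ℝ) (he : e ≠ e₁) : solitonOnDeriv p e₁ e = 0 :=
  funext fun _ => if_neg he

theorem hasDerivAt_solitonOn (hp : 1 < p) (e₁ e : E) (x : ℝ) :
    HasDerivAt (solitonOn p e₁ e) (solitonOnDeriv p e₁ e x) x := by
  rcases eq_or_ne e e₁ with rfl | he
  · rw [solitonOn_self, solitonOnDeriv_self]
    exact hasDerivAt_soliton hp x
  · rw [solitonOn_of_ne p he, solitonOnDeriv_of_ne p he]
    exact hasDerivAt_const x 0

theorem hasDerivAt_solitonOnDeriv (hp : 1 < p) (e₁ e : E) (x : ℝ) :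
    HasDerivAt (solitonOnDeriv p e₁ e) (solitonOn p e₁ e x - solitonOn p e₁ e x ^ p) x := by
  rcases eq_or_ne e e₁ with rfl | he
  · rw [solitonOn_self, solitonOnDeriv_self]
    exact hasDerivAt_solitonDeriv hp x
  · rw [solitonOn_of_ne p he, solitonOnDeriv_of_ne p he, Pi.zero_apply,
      Real.zero_rpow (by linarith), sub_zero]
    exact hasDerivAt_const x 0

theorem continuous_solitonOn (hp : 1 < p) (e₁ e : E) : Continuous (solitonOn p e₁ e) :=
  continuous_iff_continuousAt.2 fun x => (hasDerivAt_solitonOn hp e₁ e x).continuousAt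

theorem solitonOn_mem_Icc (hp : 1 < p) (e₁ e : E) (x : ℝ) :
    solitonOn p e₁ e x ∈ Icc 0 (soliton p 0) := by
  rcases eq_or_ne e e₁ with rfl | he
  · rw [solitonOn_self]
    exact ⟨(soliton_pos hp x).le, soliton_le_soliton_zero hp x⟩
  · rw [solitonOn_of_ne p he]
    exact ⟨le_rfl, (soliton_pos hp 0).le⟩

theorem abs_solitonOn_le_soliton (hp : 1 < p) (e₁ e : E) (x : ℝ) :
    |solitonOn p e₁ e x| ≤ soliton p x := by
  rcases eq_or_ne e e₁ with rfl | he
  · rw [solitonOn_self, abs_of_pos (soliton_pos hp x)]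
  · rw [solitonOn_of_ne p he, Pi.zero_apply, abs_zero]
    exact (soliton_pos hp x).le

theorem abs_solitonOnDeriv_le_soliton (hp : 1 < p) (e₁ e : E) (x : ℝ) :
    |solitonOnDeriv p e₁ e x| ≤ soliton p x := by
  rcases eq_or_ne e e₁ with rfl | he
  · rw [solitonOnDeriv_self]
    exact abs_solitonDeriv_le_soliton hp x
  · rw [solitonOnDeriv_of_ne p he, Pi.zero_apply, abs_zero]
    exact (soliton_pos hp x).le

end SolitonOn

section PendantSystem

variable {E : Type*} {K L₀ : ℝ}

open Classical in
/-- The fundamental systems of the linearised equation: `D₁` on the edge `e₁`, where the soliton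
lives, and exponentials on the other edges. -/
def pendantSystem (hK : 1 ≤ K) (D₁ : FundamentalSystem K L₀) (e₁ e : E) :
    FundamentalSystem K L₀ :=
  if e = e₁ then D₁ else expSystem hK L₀

variable {hK : 1 ≤ K} {D₁ : FundamentalSystem K L₀} {e₁ e : E}

theorem pendantSystem_self : pendantSystem hK D₁ e₁ e₁ = D₁ := if_pos rfl

theorem pendantSystem_of_ne (he : e ≠ e₁) : pendantSystem hK D₁ e₁ e = expSystem hK L₀ :=
  if_neg he

theorem pendantSystem_q {p : ℝ} (hp : 1 < p) (hq : D₁.q = solitonPotential ((p - 1) / 2)) (e : E)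
    (x : ℝ) : (pendantSystem hK D₁ e₁ e).q x = 1 - p * solitonOn p e₁ e x ^ (p - 1) := by
  rcases eq_or_ne e e₁ with rfl | he
  · rw [pendantSystem_self, solitonOn_self, hq, solitonPotential_eq hp]
  · rw [pendantSystem_of_ne he, solitonOn_of_ne p he, Pi.zero_apply,
      Real.zero_rpow (by linarith), mul_zero, sub_zero]
    rfl

end PendantSystem

/-- The edge `e₁` is the only edge end at its initial vertex. -/
structure IsPendantEdge {V E : Type*} (G : MetricGraph V E) (e₁ : E) : Prop where
  eq_of_src_eq : ∀ e, G.src e = G.src e₁ → e = e₁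
  tgt_ne : ∀ e, G.tgt e ≠ G.src e₁

variable {V E : Type*} [Fintype E]

open Classical in
/-- `v`, with derivative `v'` along the edges, solves `v'' = v - (max v 0) ^ p` on `G` with
Kirchhoff conditions. The functions are defined on whole lines, but solve the equation only on the
edges. -/
structure IsTransmissionSolution (G : MetricGraph V E) (p : ℝ) (v v' : E → ℝ → ℝ) : Prop where
  hasDerivAt : ∀ e x, HasDerivAt (v e) (v' e x) x
  hasDerivAt' : ∀ e, ∀ x ∈ Icc 0 (G.len e),
    HasDerivAt (v' e) (v e x - max (v e x) 0 ^ p) x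
  vertex : ∃ val : V → ℝ, ∀ e, v e 0 = val (G.src e) ∧ v e (G.len e) = val (G.tgt e)
  kirchhoff : ∀ w, (∑ e with G.src e = w, v' e 0) + ∑ e with G.tgt e = w, -v' e (G.len e) = 0

section Assembly

variable {G : MetricGraph V E} {K L₀ p : ℝ} {hK : 1 ≤ K} {D₁ : FundamentalSystem K L₀} {e₁ : E}
  {d : EdgeData E} (hp : 1 < p) (he₁ : G.IsPendantEdge e₁)
  (hd : G.balance (pendantSystem hK D₁ e₁) e₁ d = d)

open Classical in
theorem IsPendantEdge.sum_src (he₁ : G.IsPendantEdge e₁) (f : E → ℝ) :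
    ∑ e with G.src e = G.src e₁, f e = f e₁ := by
  have : Finset.univ.filter (fun e => G.src e = G.src e₁) = {e₁} := by
    ext e
    simpa using ⟨he₁.eq_of_src_eq e, fun h => by rw [h]⟩
  rw [this, Finset.sum_singleton]

open Classical in
theorem IsPendantEdge.sum_tgt (he₁ : G.IsPendantEdge e₁) (f : E → ℝ) :
    ∑ e with G.tgt e = G.src e₁, f e = 0 :=
  Finset.sum_eq_zero fun e he => absurd (Finset.mem_filter.1 he).2 (he₁.tgt_ne e)

include he₁ hd

theorem exists_vertexVal_of_balance_eq (hL : ∀ e, L₀ ≤ G.len e)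
    (ho : d.offset = fun e => solitonOn p e₁ e (G.len e)) :
    ∃ val : V → ℝ, ∀ e,
      solitonOn p e₁ e 0 + G.edgeSol (pendantSystem hK D₁ e₁) d e 0 = val (G.src e) ∧
      solitonOn p e₁ e (G.len e) + G.edgeSol (pendantSystem hK D₁ e₁) d e (G.len e) =
        val (G.tgt e) := by
  classical
  refine ⟨Function.update (G.vertexVal (pendantSystem hK D₁ e₁) d) (G.src e₁)
    (solitonOn p e₁ e₁ 0 + G.edgeSol (pendantSystem hK D₁ e₁) d e₁ 0), fun e => ⟨?_, ?_⟩⟩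
  · rcases eq_or_ne e e₁ with rfl | he
    · rw [Function.update_self]
    · rw [Function.update_of_ne fun h => he (he₁.eq_of_src_eq e h), solitonOn_of_ne p he,
        Pi.zero_apply, zero_add]
      exact edgeSol_zero_of_balance_eq hd he (by simp [pendantSystem_of_ne he, expSystem])
        (by simp [pendantSystem_of_ne he, expSystem])
  · rw [Function.update_of_ne (he₁.tgt_ne e), ← edgeSol_len_of_balance_eq hd (hL e), ho, add_comm]

open Classical in
theorem kirchhoff_solitonOn_add_of_balance_eq (hL : ∀ e, L₀ ≤ G.len e) (hQ' : D₁.Q' 0 = 0)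
    (ho' : d.slopeOffset = fun e => -solitonOnDeriv p e₁ e (G.len e)) (w : V) :
    (∑ e with G.src e = w,
      (solitonOnDeriv p e₁ e 0 + G.edgeSolDeriv (pendantSystem hK D₁ e₁) d e 0)) +
    ∑ e with G.tgt e = w, -(solitonOnDeriv p e₁ e (G.len e) +
      G.edgeSolDeriv (pendantSystem hK D₁ e₁) d e (G.len e)) = 0 := by
  rcases eq_or_ne w (G.src e₁) with rfl | hw
  · rw [he₁.sum_src, he₁.sum_tgt, solitonOnDeriv_self, solitonDeriv_zero,
      edgeSolDeriv_zero_pendant_of_balance_eq hd (by rw [pendantSystem_self, hQ']), zero_add,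
      add_zero]
  · refine Eq.trans ?_ (kirchhoff_of_balance_eq hd hL hw
      (fun e he => by simp [pendantSystem_of_ne he, expSystem])
      (fun e he => by simp [pendantSystem_of_ne he, expSystem]))
    refine congrArg₂ (· + ·) (Finset.sum_congr rfl fun e he => ?_)
      (Finset.sum_congr rfl fun e _ => ?_)
    · have hne : e ≠ e₁ := fun h => hw (by rw [← (Finset.mem_filter.1 he).2, h])
      rw [solitonOnDeriv_of_ne p hne, Pi.zero_apply, zero_add]
    · rw [ho', neg_add_rev]

include hp

theorem isTransmissionSolution_of_balance_eq (hL : ∀ e, L₀ ≤ G.len e)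
    (hq : D₁.q = solitonPotential ((p - 1) / 2)) (hQ' : D₁.Q' 0 = 0)
    (ho : d.offset = fun e => solitonOn p e₁ e (G.len e))
    (ho' : d.slopeOffset = fun e => -solitonOnDeriv p e₁ e (G.len e))
    (hcont : ∀ e, Continuous (d.source e))
    (hsource : ∀ e, ∀ x ∈ Icc 0 (G.len e), d.source e x =
      powRemainder p (solitonOn p e₁ e x) (G.edgeSol (pendantSystem hK D₁ e₁) d e x)) :
    G.IsTransmissionSolution p
      (fun e x => solitonOn p e₁ e x + G.edgeSol (pendantSystem hK D₁ e₁) d e x)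
      (fun e x => solitonOnDeriv p e₁ e x + G.edgeSolDeriv (pendantSystem hK D₁ e₁) d e x) where
  hasDerivAt e x := (hasDerivAt_solitonOn hp e₁ e x).add
    ((pendantSystem hK D₁ e₁ e).hasDerivAt_sol (hcont e) _ _ x)
  hasDerivAt' e x hx := by
    refine ((hasDerivAt_solitonOnDeriv hp e₁ e x).add
      ((pendantSystem hK D₁ e₁ e).hasDerivAt_solDeriv (L := G.len e) (hcont e) (d.decay e)
        (d.grow e) x)).congr_deriv ?_
    rw [pendantSystem_q hp hq, hsource e x hx, powRemainder, edgeSol]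
    ring
  vertex := exists_vertexVal_of_balance_eq he₁ hd hL ho
  kirchhoff := kirchhoff_solitonOn_add_of_balance_eq he₁ hd hL hQ' ho'

end Assembly

section Offsets

variable {G : MetricGraph V E} {p K : ℝ} (hp : 1 < p)
  (hK : ((p + 1) / 2) ^ (1 / (p - 1)) * 2 ^ (1 / ((p - 1) / 2)) ≤ K)
include hp hK

omit [Fintype E] in
theorem abs_solitonOn_len_le (e₁ e : E) :
    |solitonOn p e₁ e (G.len e)| ≤ K * Real.exp (-G.len e₁) := by
  rcases eq_or_ne e e₁ with rfl | he
  · rw [solitonOn_self, abs_of_pos (soliton_pos hp _)]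
    exact (soliton_le_exp hp _).trans (by gcongr)
  · rw [solitonOn_of_ne p he, Pi.zero_apply, abs_zero]
    exact mul_nonneg (le_trans (by positivity) hK) (Real.exp_pos _).le

omit [Fintype E] in
theorem abs_neg_solitonOnDeriv_len_le (e₁ e : E) :
    |-solitonOnDeriv p e₁ e (G.len e)| ≤ K * Real.exp (-G.len e₁) := by
  rw [abs_neg]
  rcases eq_or_ne e e₁ with rfl | he
  · rw [solitonOnDeriv_self]
    exact (abs_solitonDeriv_le_soliton hp _).trans ((soliton_le_exp hp _).trans (by gcongr))
  · rw [solitonOnDeriv_of_ne p he, Pi.zero_apply, abs_zero]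
    exact mul_nonneg (le_trans (by positivity) hK) (Real.exp_pos _).le

end Offsets

theorem exists_exp_neg_small {K δ : ℝ} (hK : 0 < K) (hδ : 0 < δ) : ∃ ℓ : ℝ,
    16 * K ^ 6 * (Real.exp (-ℓ) + 1 / (32 * K ^ 6)) ≤ 1 ∧ 16 * K ^ 4 * Real.exp (-ℓ) ≤ δ := by
  have hexp := Real.tendsto_exp_neg_atTop_nhds_zero
  obtain ⟨ℓ, hℓ, hℓδ⟩ := ((hexp.eventually (ge_mem_nhds
    (show 0 < 1 / (32 * K ^ 6) by positivity))).and (hexp.eventually (ge_mem_nhds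
      (show 0 < δ / (16 * K ^ 4) by positivity)))).exists
  refine ⟨ℓ, ?_, (le_div_iff₀' (by positivity)).1 hℓδ⟩
  have hε : 32 * K ^ 6 * (1 / (32 * K ^ 6)) = 1 := mul_one_div_cancel (by positivity)
  have hle := mul_le_mul_of_nonneg_left hℓ (show 0 ≤ 16 * K ^ 6 by positivity)
  linarith

theorem exists_solution_near_soliton (V E : Type*) [Fintype E] {p : ℝ} (hp : 1 < p) :
    ∃ L C : ℝ, 0 < C ∧ ∀ (G : MetricGraph V E) (e₁ : E), (∀ e, L ≤ G.len e) →
      G.IsPendantEdge e₁ → ∃ v v' : E → ℝ → ℝ, G.IsTransmissionSolution p v v' ∧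
        ∀ e, ∀ x ∈ Icc 0 (G.len e), |v e x - solitonOn p e₁ e x| ≤ C * Real.exp (-G.len e₁) ∧
          |v' e x - solitonOnDeriv p e₁ e x| ≤ C * Real.exp (-G.len e₁) := by
  obtain ⟨L₀, hsys⟩ := exists_solitonSystem (show 0 < (p - 1) / 2 by linarith)
  obtain ⟨K, ⟨D₁, hq, hQ'⟩, hU, hK⟩ := (hsys.and ((eventually_ge_atTop
    (((p + 1) / 2) ^ (1 / (p - 1)) * 2 ^ (1 / ((p - 1) / 2)))).and (eventually_ge_atTop 1))).exists
  obtain ⟨δ, hδ, hN⟩ := exists_lipschitzTerm_eq_powRemainder hp (soliton p 0)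
    (show 0 < 1 / (32 * K ^ 6) by positivity)
  obtain ⟨ℓ, hsmall, hℓδ⟩ := exists_exp_neg_small (one_pos.trans_le hK) hδ
  refine ⟨max L₀ ℓ, 48 * K ^ 6, by positivity, fun G e₁ hlen he₁ => ?_⟩
  have hL : ∀ e, L₀ ≤ G.len e := fun e => (le_max_left _ _).trans (hlen e)
  have hℓ : ∀ e, ℓ ≤ G.len e := fun e => (le_max_right _ _).trans (hlen e)
  choose N hN using fun e =>
    hN (solitonOn p e₁ e) (continuous_solitonOn hp e₁ e) (solitonOn_mem_Icc hp e₁ e)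
  set η := Real.exp (-G.len e₁)
  have hη : 16 * K ^ 3 * (K * η) ≤ δ :=
    calc 16 * K ^ 3 * (K * η) = 16 * K ^ 4 * η := by ring
      _ ≤ 16 * K ^ 4 * Real.exp (-ℓ) :=
        mul_le_mul_of_nonneg_left (Real.exp_le_exp.2 (neg_le_neg (hℓ e₁))) (by positivity)
      _ ≤ δ := hℓδ
  obtain ⟨d, ho, ho', hcont, hd, hsol⟩ := exists_small_transmission_solution
    (D := pendantSystem hK D₁ e₁) (N := N) (e₁ := e₁) hK hℓ hL (by positivity) hsmall
    (show 0 ≤ K * η by positivity) (abs_solitonOn_len_le (G := G) hp hU e₁)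
    (abs_neg_solitonOnDeriv_len_le (G := G) hp hU e₁)
  refine ⟨_, _, isTransmissionSolution_of_balance_eq hp he₁ hd hL hq hQ' ho ho' hcont
    fun e x hx => (hsol e x hx).1.trans (hN e x _ ((hsol e x hx).2.1.trans hη)),
    fun e x hx => ⟨?_, ?_⟩⟩
  · rw [add_sub_cancel_left]
    calc |G.edgeSol (pendantSystem hK D₁ e₁) d e x| ≤ 16 * K ^ 3 * (K * η) := (hsol e x hx).2.1
      _ = 16 * K ^ 4 * η := by ring
      _ ≤ 48 * K ^ 6 * η := by gcongr <;> norm_num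
  · rw [add_sub_cancel_left]
    exact (hsol e x hx).2.2.trans_eq (by ring)

end MetricGraph

/-! ### Positivity and the single peak -/

theorem mul_deriv_nonneg_of_isMinOn {s : Set ℝ} (hs : Convex ℝ s) {f : ℝ → ℝ} {d x y : ℝ}
    (hf : HasDerivAt f d x) (hmin : IsMinOn f s x) (hx : x ∈ s) (hy : y ∈ s) :
    0 ≤ (y - x) * d := by
  simpa using hmin.localize.hasFDerivWithinAt_nonneg hf.hasFDerivAt.hasFDerivWithinAt
    (sub_mem_posTangentConeAt_of_segment_subset (hs.segment_subset hx hy))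

theorem nonpos_of_hasDerivAt_le_mul {f f' : ℝ → ℝ} {a b c : ℝ}
    (hf : ∀ z ∈ Icc a b, HasDerivAt f (f' z) z) (hle : ∀ z ∈ Icc a b, f' z ≤ c * f z)
    (ha : f a ≤ 0) : ∀ z ∈ Icc a b, f z ≤ 0 := fun z hz => by
  simpa [gronwallBound_ε0_δ0] using le_gronwallBound_of_liminf_deriv_right_le (ε := 0)
    (fun w hw => (hf w hw).continuousAt.continuousWithinAt)
    (fun w hw _ hr =>
      (hf w (Ico_subset_Icc_self hw)).hasDerivWithinAt.liminf_right_slope_le hr) ha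
    (fun w hw => (hle w (Ico_subset_Icc_self hw)).trans_eq (add_zero _).symm) z hz

section SecondOrder

variable {f f' f'' : ℝ → ℝ} {a b x : ℝ}

-- The inequality `f'' ≤ f` factors as `(f' + f)' ≤ f' + f`, then `f' ≤ -f`.
theorem nonpos_of_second_deriv_le_right (hf : ∀ z, HasDerivAt f (f' z) z)
    (hf' : ∀ z ∈ Icc a b, HasDerivAt f' (f'' z) z) (hle : ∀ z ∈ Icc a b, f'' z ≤ f z)
    (h0 : f a = 0) (h1 : f' a = 0) : ∀ z ∈ Icc a b, f z ≤ 0 := by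
  have hsum : ∀ z ∈ Icc a b, f' z + f z ≤ 0 :=
    nonpos_of_hasDerivAt_le_mul (c := 1) (fun z hz => (hf' z hz).add (hf z))
      (fun z hz => by linarith [hle z hz]) (by rw [h0, h1, add_zero])
  exact nonpos_of_hasDerivAt_le_mul (c := -1) (fun z _ => hf z)
    (fun z hz => by linarith [hsum z hz]) h0.le

theorem nonpos_of_second_deriv_le (hf : ∀ z, HasDerivAt f (f' z) z)
    (hf' : ∀ z ∈ Icc a b, HasDerivAt f' (f'' z) z) (hle : ∀ z ∈ Icc a b, f'' z ≤ f z)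
    (hx : x ∈ Icc a b) (h0 : f x = 0) (h1 : f' x = 0) : ∀ z ∈ Icc a b, f z ≤ 0 := fun z hz => by
  rcases le_total x z with hxz | hxz
  · have hsub : Icc x b ⊆ Icc a b := Icc_subset_Icc_left hx.1
    exact nonpos_of_second_deriv_le_right hf (fun w hw => hf' w (hsub hw))
      (fun w hw => hle w (hsub hw)) h0 h1 z ⟨hxz, hz.2⟩
  · have hsub : ∀ w ∈ Icc (-x) (-a), -w ∈ Icc a b := fun w hw =>
      ⟨by linarith [hw.2], by linarith [hw.1, hx.2]⟩
    simpa using nonpos_of_second_deriv_le_right (f := fun w => f (-w)) (f' := fun w => -f' (-w))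
      (f'' := fun w => f'' (-w))
      (fun w => ((hf (-w)).comp w (hasDerivAt_neg w)).congr_deriv (by ring))
      (fun w hw => ((hf' (-w) (hsub w hw)).comp w (hasDerivAt_neg w)).neg.congr_deriv (by ring))
      (fun w hw => hle (-w) (hsub w hw)) (by simpa using h0) (by simpa using h1) (-z)
      ⟨neg_le_neg hxz, neg_le_neg hz.1⟩

end SecondOrder

namespace MetricGraph

variable {V E : Type*} [Fintype E] {G : MetricGraph V E} {p : ℝ} {v v' : E → ℝ → ℝ}

omit [Fintype E] in
theorem zero_mem_Icc_len (G : MetricGraph V E) (e : E) : (0 : ℝ) ∈ Icc 0 (G.len e) :=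
  left_mem_Icc.2 (G.len_pos e).le

omit [Fintype E] in
theorem len_mem_Icc_len (G : MetricGraph V E) (e : E) : G.len e ∈ Icc 0 (G.len e) :=
  right_mem_Icc.2 (G.len_pos e).le

omit [Fintype E] in
theorem exists_forall_le_of_continuous [Finite E] [Nonempty E] (G : MetricGraph V E)
    (hv : ∀ e, Continuous (v e)) :
    ∃ e₀, ∃ x₀ ∈ Icc 0 (G.len e₀), ∀ e, ∀ x ∈ Icc 0 (G.len e), v e₀ x₀ ≤ v e x := by
  choose y hy hmin using fun e => isCompact_Icc.exists_isMinOn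
    ⟨0, G.zero_mem_Icc_len e⟩ (hv e).continuousOn
  obtain ⟨e₀, he₀⟩ := Finite.exists_min fun e => v e (y e)
  exact ⟨e₀, y e₀, hy e₀, fun e x hx => (he₀ e).trans (hmin e hx)⟩

namespace IsTransmissionSolution

section Minimum

variable {m : ℝ} {e : E} {x : ℝ} (h : G.IsTransmissionSolution p v v')
  (hmin : ∀ e, ∀ z ∈ Icc 0 (G.len e), m ≤ v e z)
include h hmin

theorem mul_deriv_nonneg_of_eq_min (hx : x ∈ Icc 0 (G.len e)) (hxm : v e x = m) {y : ℝ}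
    (hy : y ∈ Icc 0 (G.len e)) : 0 ≤ (y - x) * v' e x :=
  mul_deriv_nonneg_of_isMinOn (convex_Icc 0 (G.len e)) (h.hasDerivAt e x)
    (fun z hz => hxm.trans_le (hmin e z hz)) hx hy

-- At a vertex the outgoing slopes are nonnegative, and their sum vanishes.
theorem deriv_eq_zero_of_vertex_eq_min {val : V → ℝ}
    (hval : ∀ e, v e 0 = val (G.src e) ∧ v e (G.len e) = val (G.tgt e)) {w : V} (hw : val w = m) :
    (∀ e, G.src e = w → v' e 0 = 0) ∧ ∀ e, G.tgt e = w → v' e (G.len e) = 0 := by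
  classical
  have hsrc : ∀ e ∈ Finset.univ.filter (G.src · = w), 0 ≤ v' e 0 := fun e he => by
    have := h.mul_deriv_nonneg_of_eq_min hmin (G.zero_mem_Icc_len e)
      (by rw [(hval e).1, (Finset.mem_filter.1 he).2, hw]) (G.len_mem_Icc_len e)
    rw [sub_zero] at this
    exact nonneg_of_mul_nonneg_right this (G.len_pos e)
  have htgt : ∀ e ∈ Finset.univ.filter (G.tgt · = w), 0 ≤ -v' e (G.len e) := fun e he => by
    have := h.mul_deriv_nonneg_of_eq_min hmin (G.len_mem_Icc_len e)
      (by rw [(hval e).2, (Finset.mem_filter.1 he).2, hw]) (G.zero_mem_Icc_len e)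
    rw [zero_sub, neg_mul_comm] at this
    exact nonneg_of_mul_nonneg_right this (G.len_pos e)
  obtain ⟨hs, ht⟩ := (add_eq_zero_iff_of_nonneg (Finset.sum_nonneg hsrc)
    (Finset.sum_nonneg htgt)).1 (h.kirchhoff w)
  exact ⟨fun e he => (Finset.sum_eq_zero_iff_of_nonneg hsrc).1 hs e (by simp [he]),
    fun e he => neg_eq_zero.1 ((Finset.sum_eq_zero_iff_of_nonneg htgt).1 ht e (by simp [he]))⟩

theorem deriv_eq_zero_of_eq_min (hx : x ∈ Icc 0 (G.len e)) (hxm : v e x = m) : v' e x = 0 := by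
  obtain ⟨val, hval⟩ := h.vertex
  rcases hx.1.eq_or_lt with rfl | h0
  · exact (h.deriv_eq_zero_of_vertex_eq_min hmin hval ((hval e).1.symm.trans hxm)).1 e rfl
  rcases hx.2.eq_or_lt with rfl | hL
  · exact (h.deriv_eq_zero_of_vertex_eq_min hmin hval ((hval e).2.symm.trans hxm)).2 e rfl
  · have hlocal : IsLocalMin (v e) x := by
      filter_upwards [Icc_mem_nhds h0 hL] with z hz using hxm.trans_le (hmin e z hz)
    exact hlocal.hasDerivAt_eq_zero (h.hasDerivAt e x)

theorem eq_min_of_eq_min (hm : m ≤ 0) (hx : x ∈ Icc 0 (G.len e)) (hxm : v e x = m) :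
    ∀ z ∈ Icc 0 (G.len e), v e z = m := fun z hz => by
  refine le_antisymm (sub_nonpos.1 ?_) (hmin e z hz)
  exact nonpos_of_second_deriv_le (f := fun z => v e z - m)
    (fun z => (h.hasDerivAt e z).sub_const m) (h.hasDerivAt' e)
    (fun z _ => by linarith [Real.rpow_nonneg (le_max_right (v e z) 0) p]) hx (sub_eq_zero.2 hxm)
    (h.deriv_eq_zero_of_eq_min hmin hx hxm) z hz

end Minimum

theorem nonneg (h : G.IsTransmissionSolution p v v') (hp : 1 < p) {e : E} {x : ℝ}
    (hx : x ∈ Icc 0 (G.len e)) : 0 ≤ v e x := by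
  have : Nonempty E := ⟨e⟩
  obtain ⟨e₀, x₀, hx₀, hmin⟩ := G.exists_forall_le_of_continuous fun e =>
    continuous_iff_continuousAt.2 fun x => (h.hasDerivAt e x).continuousAt
  refine le_trans ?_ (hmin e x hx)
  by_contra! hneg
  set m := v e₀ x₀
  have hconst := h.eq_min_of_eq_min hmin hneg.le hx₀ rfl
  obtain ⟨y, hy⟩ := nonempty_Ioo.2 (G.len_pos e₀)
  have hy' := Ioo_subset_Icc_self hy
  have hzero : v' e₀ =ᶠ[𝓝 y] fun _ => 0 := by
    filter_upwards [Icc_mem_nhds hy.1 hy.2] with z hz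
    exact h.deriv_eq_zero_of_eq_min hmin hz (hconst z hz)
  have hsecond := (h.hasDerivAt' e₀ y hy').unique
    ((hasDerivAt_const y (0 : ℝ)).congr_of_eventuallyEq hzero)
  rw [hconst y hy', max_eq_right hneg.le, Real.zero_rpow (by linarith), sub_zero] at hsecond
  exact hneg.ne hsecond

theorem eq_zero_of_isConnected (h : G.IsTransmissionSolution p v v') (hp : 1 < p)
    (hconn : G.IsConnected) {e e₁ : E} {x : ℝ} (hx : x ∈ Icc 0 (G.len e)) (hzero : v e x = 0) :
    v e₁ 0 = 0 := by
  have hedge : ∀ e, ∀ y ∈ Icc 0 (G.len e), v e y = 0 → ∀ z ∈ Icc 0 (G.len e), v e z = 0 :=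
    fun e y hy hy0 => h.eq_min_of_eq_min (fun e z hz => h.nonneg hp hz) le_rfl hy hy0
  obtain ⟨val, hval⟩ := h.vertex
  have hwalk : ∀ {u w : V}, (SimpleGraph.fromRel fun v w => ∃ e, G.src e = v ∧ G.tgt e = w).Walk
      u w → val u = 0 → val w = 0 := by
    intro u w q
    induction q with
    | nil => exact id
    | cons hadj _ ih =>
      refine fun hu => ih ?_
      rcases ((SimpleGraph.fromRel_adj _ _ _).1 hadj).2 with ⟨e, rfl, rfl⟩ | ⟨e, rfl, rfl⟩
      · exact (hval e).2 ▸ hedge e 0 (G.zero_mem_Icc_len e) ((hval e).1.trans hu) _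
          (G.len_mem_Icc_len e)
      · exact (hval e).1 ▸ hedge e _ (G.len_mem_Icc_len e) ((hval e).2.trans hu) _
          (G.zero_mem_Icc_len e)
  obtain ⟨q⟩ := hconn.preconnected (G.src e) (G.src e₁)
  rw [(hval e₁).1]
  exact hwalk q ((hval e).1 ▸ hedge e x hx hzero 0 (G.zero_mem_Icc_len e))

theorem pos (h : G.IsTransmissionSolution p v v') (hp : 1 < p) (hconn : G.IsConnected)
    {e₁ : E} (h₁ : v e₁ 0 ≠ 0) {e : E} {x : ℝ} (hx : x ∈ Icc 0 (G.len e)) : 0 < v e x :=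
  (h.nonneg hp hx).lt_of_ne' fun hzero => h₁ (h.eq_zero_of_isConnected hp hconn hx hzero)

theorem deriv_zero_pendant (h : G.IsTransmissionSolution p v v') {e₁ : E}
    (he₁ : G.IsPendantEdge e₁) : v' e₁ 0 = 0 := by
  have hk := h.kirchhoff (G.src e₁)
  rwa [he₁.sum_src, he₁.sum_tgt, add_zero] at hk

theorem strictAntiOn_of_one_lt (h : G.IsTransmissionSolution p v v') (hp : 1 < p) {e : E} {b : ℝ}
    (hb : b ≤ G.len e) (h0 : v' e 0 = 0) (hone : ∀ z ∈ Icc 0 b, 1 < v e z) :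
    StrictAntiOn (v e) (Icc 0 b) := by
  have hslope : StrictAntiOn (v' e) (Icc 0 b) := by
    have hderiv : ∀ z ∈ Icc 0 b, HasDerivAt (v' e) (v e z - max (v e z) 0 ^ p) z := fun z hz =>
      h.hasDerivAt' e z ⟨hz.1, hz.2.trans hb⟩
    refine strictAntiOn_of_deriv_neg (convex_Icc 0 b)
      (fun z hz => (hderiv z hz).continuousAt.continuousWithinAt) fun z hz => ?_
    have hz := interior_subset hz
    rw [(hderiv z hz).deriv, max_eq_left (zero_lt_one.trans (hone z hz)).le, sub_neg]
    exact Real.self_lt_rpow_of_one_lt (hone z hz) hp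
  refine strictAntiOn_of_deriv_neg (convex_Icc 0 b)
    (fun z _ => (h.hasDerivAt e z).continuousAt.continuousWithinAt) fun z hz => ?_
  rw [interior_Icc] at hz
  rw [(h.hasDerivAt e z).deriv, ← h0]
  exact hslope ⟨le_rfl, (hz.1.trans hz.2).le⟩ (Ioo_subset_Icc_self hz) hz.1

end IsTransmissionSolution

theorem exists_one_lt_soliton {p : ℝ} (hp : 1 < p) : ∃ x₀ > 0, 1 < soliton p x₀ := by
  have hnear : ∀ᶠ x in 𝓝[>] (0 : ℝ), 1 < soliton p x := nhdsWithin_le_nhds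
    ((continuous_soliton hp).continuousAt.eventually (lt_mem_nhds (one_lt_soliton_zero hp)))
  obtain ⟨x, hx, hx0⟩ := (hnear.and self_mem_nhdsWithin).exists
  exact ⟨x, hx0, hx⟩

theorem exists_peak_threshold (V E : Type*) [Fintype E] {p : ℝ} (hp : 1 < p) :
    ∃ η > 0, ∀ (G : MetricGraph V E) (e₁ : E), G.IsPendantEdge e₁ →
      ∀ v v' : E → ℝ → ℝ, G.IsTransmissionSolution p v v' →
      (∀ e, ∀ x ∈ Icc 0 (G.len e), |v e x - solitonOn p e₁ e x| ≤ η) →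
      v e₁ 0 ≠ 0 ∧ ∀ e, ∀ x ∈ Icc 0 (G.len e), (e, x) ≠ (e₁, 0) → v e x < v e₁ 0 := by
  obtain ⟨x₀, hx₀, hU₀⟩ := exists_one_lt_soliton hp
  have hanti := soliton_strictAntiOn hp
  have hlt : soliton p x₀ < soliton p 0 := hanti self_mem_Ici hx₀.le hx₀
  refine ⟨min ((soliton p x₀ - 1) / 2) ((soliton p 0 - soliton p x₀) / 3),
    lt_min (by linarith) (by linarith), fun G e₁ he₁ v v' h hclose => ?_⟩
  set η := min ((soliton p x₀ - 1) / 2) ((soliton p 0 - soliton p x₀) / 3)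
  have hη₁ : η ≤ (soliton p x₀ - 1) / 2 := min_le_left _ _
  have hη₂ : η ≤ (soliton p 0 - soliton p x₀) / 3 := min_le_right _ _
  have hnear : ∀ x ∈ Icc 0 (G.len e₁), |v e₁ x - soliton p x| ≤ η := fun x hx =>
    solitonOn_self p e₁ ▸ hclose e₁ x hx
  have hpeak := (abs_le.1 (hnear 0 (G.zero_mem_Icc_len e₁))).1
  refine ⟨fun hz => by linarith, fun e x hx hne => ?_⟩
  rcases ne_or_eq e e₁ with he | rfl
  · have := (abs_le.1 (hclose e x hx)).2
    rw [solitonOn_of_ne p he, Pi.zero_apply] at this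
    linarith
  have hx0 : 0 < x := hx.1.lt_of_ne' fun hx => hne (by rw [hx])
  rcases le_total x₀ x with hfar | hclose
  · have hxx₀ : soliton p x ≤ soliton p x₀ := hanti.antitoneOn hx₀.le hx.1 hfar
    linarith [(abs_le.1 (hnear x hx)).2]
  · refine h.strictAntiOn_of_one_lt hp hx.2 (h.deriv_zero_pendant he₁) (fun z hz => ?_)
      (left_mem_Icc.2 hx.1) (right_mem_Icc.2 hx.1) hx0
    have hx₀z : soliton p x₀ ≤ soliton p z := hanti.antitoneOn hz.1 hx₀.le (hz.2.trans hclose)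
    linarith [(abs_le.1 (hnear z ⟨hz.1, hz.2.trans hx.2⟩)).1]

end MetricGraph

/-! ### Rescaling -/

section WeakDerivatives

variable {f f' : ℝ → ℝ} {l : ℝ}

theorem memLp_restrict_Ioo_of_continuousOn {a b : ℝ} (hf : ContinuousOn f (Icc a b))
    (q : ENNReal) : MemLp f q (volume.restrict (Ioo a b)) := by
  obtain ⟨C, hC⟩ := isCompact_Icc.exists_bound_of_continuousOn hf
  refine MemLp.of_bound
    ((hf.mono Ioo_subset_Icc_self).aestronglyMeasurable measurableSet_Ioo) C ?_
  filter_upwards [ae_restrict_mem measurableSet_Ioo] with x hx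
  exact hC x (Ioo_subset_Icc_self hx)

theorem setIntegral_Ioo_eq_intervalIntegral {a b : ℝ} (hab : a ≤ b) (f : ℝ → ℝ) :
    ∫ x in Ioo a b, f x = ∫ x in a..b, f x := by
  rw [intervalIntegral.integral_of_le hab, integral_Ioc_eq_integral_Ioo]

theorem isWeakDerivL2_of_hasDerivAt (hl : 0 ≤ l) (hf : ∀ x ∈ Icc 0 l, HasDerivAt f (f' x) x)
    (hf' : ContinuousOn f' (Icc 0 l)) : IsWeakDerivL2 l f f' := by
  refine ⟨memLp_restrict_Ioo_of_continuousOn hf' 2, fun ψ hψ _ hs => ?_⟩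
  have h0 : ψ 0 = 0 := image_eq_zero_of_notMem_tsupport fun h => (hs h).1.false
  have hl' : ψ l = 0 := image_eq_zero_of_notMem_tsupport fun h => (hs h).2.false
  have hψ' : ∀ x, HasDerivAt ψ (deriv ψ x) x := fun x =>
    (hψ.differentiable (by simp) x).hasDerivAt
  rw [← uIcc_of_le hl] at hf hf'
  rw [setIntegral_Ioo_eq_intervalIntegral hl, setIntegral_Ioo_eq_intervalIntegral hl,
    intervalIntegral.integral_mul_deriv_eq_deriv_mul hf (fun x _ => hψ' x) hf'.intervalIntegrable
      ((hψ.continuous_deriv (by simp)).intervalIntegrable _ _), h0, hl', mul_zero, mul_zero,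
    sub_zero, zero_sub]

theorem memH1Interval_of_hasDerivAt (hl : 0 ≤ l) (hf : ∀ x ∈ Icc 0 l, HasDerivAt f (f' x) x)
    (hf' : ContinuousOn f' (Icc 0 l)) : MemH1Interval l f :=
  ⟨memLp_restrict_Ioo_of_continuousOn (HasDerivAt.continuousOn hf) 2, f',
    isWeakDerivL2_of_hasDerivAt hl hf hf'⟩

theorem IsWeakDerivL2.ae_eq {g h : ℝ → ℝ} (hg : IsWeakDerivL2 l f g)
    (hh : IsWeakDerivL2 l f h) : g =ᵐ[volume.restrict (Ioo 0 l)] h := by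
  have hloc : LocallyIntegrableOn (g - h) (Ioo 0 l) volume :=
    IntegrableOn.locallyIntegrableOn ((hg.1.sub hh.1).integrable (by norm_num))
  have hzero : ∀ᵐ x, x ∈ Ioo 0 l → (g - h) x = 0 :=
    isOpen_Ioo.ae_eq_zero_of_integral_contDiff_smul_eq_zero hloc fun ψ hψ hψc hψs => by
      have hψ2 := memLp_restrict_Ioo_of_continuousOn (hψ.continuous.continuousOn (s := Icc 0 l)) 2
      calc ∫ x, ψ x • (g - h) x = ∫ x in Ioo 0 l, ψ x • (g - h) x :=
            (setIntegral_eq_integral_of_forall_compl_eq_zero fun x hx => by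
              rw [image_eq_zero_of_notMem_tsupport fun h => hx (hψs h), zero_smul]).symm
        _ = ∫ x in Ioo 0 l, (g x * ψ x - h x * ψ x) := by
            simp only [smul_eq_mul, Pi.sub_apply, mul_comm (ψ _), sub_mul]
        _ = (∫ x in Ioo 0 l, g x * ψ x) - ∫ x in Ioo 0 l, h x * ψ x :=
            integral_sub (hg.1.integrable_mul hψ2) (hh.1.integrable_mul hψ2)
        _ = 0 := by linarith [hg.2 ψ hψ hψc hψs, hh.2 ψ hψ hψc hψs]
  rw [EventuallyEq, ae_restrict_iff' measurableSet_Ioo]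
  filter_upwards [hzero] with x hx hxI
  exact sub_eq_zero.1 (hx hxI)

theorem weakDeriv_ae_eq {g : ℝ → ℝ} (hg : IsWeakDerivL2 l f g) :
    weakDeriv l f =ᵐ[volume.restrict (Ioo 0 l)] g := by
  have hex : ∃ g, IsWeakDerivL2 l f g := ⟨g, hg⟩
  rw [weakDeriv, dif_pos hex]
  exact hex.choose_spec.ae_eq hg

end WeakDerivatives

section SecondDerivatives

variable {f f' f'' : ℝ → ℝ} {s : Set ℝ} (hs : UniqueDiffOn ℝ s)
  (hf : ∀ x ∈ s, HasDerivWithinAt f (f' x) s x) (hf' : ∀ x ∈ s, HasDerivWithinAt f' (f'' x) s x)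
include hs hf hf'

theorem contDiffOn_two_of_hasDerivWithinAt (hf'' : ContinuousOn f'' s) : ContDiffOn ℝ 2 f s := by
  have hderiv : EqOn (derivWithin f s) f' s := fun x hx => (hf x hx).derivWithin (hs x hx)
  have hderiv' : EqOn (derivWithin f' s) f'' s := fun x hx => (hf' x hx).derivWithin (hs x hx)
  rw [show (2 : WithTop ℕ∞) = 1 + 1 by norm_num, contDiffOn_succ_iff_derivWithin hs]
  refine ⟨fun x hx => (hf x hx).differentiableWithinAt, by simp, ContDiffOn.congr ?_ hderiv⟩
  exact (contDiffOn_one_iff_derivWithin hs).2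
    ⟨fun x hx => (hf' x hx).differentiableWithinAt, hf''.congr hderiv'⟩

theorem iteratedDerivWithin_two_of_hasDerivWithinAt {x : ℝ} (hx : x ∈ s) :
    iteratedDerivWithin 2 f s x = f'' x := by
  have hderiv : EqOn (derivWithin f s) f' s := fun x hx => (hf x hx).derivWithin (hs x hx)
  rw [iteratedDerivWithin_succ, iteratedDerivWithin_one, derivWithin_congr hderiv (hderiv hx),
    (hf' x hx).derivWithin (hs x hx)]

end SecondDerivatives

namespace MetricGraph

section Rescale

variable {E : Type*}

/-- The family `v` on a graph stretched by the factor `√lam`, transplanted to the original graph and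
multiplied by `lam ^ (1 / (p - 1))`: this turns solutions of `-v'' + v = v ^ p` into solutions of
`-u'' + lam u = u ^ p`. -/
def rescale (p lam : ℝ) (v : E → ℝ → ℝ) (e : E) (x : ℝ) : ℝ :=
  lam ^ (1 / (p - 1)) * v e (√lam * x)

/-- The derivative of `rescale p lam v`, expressed through the derivative `v'` of `v`. -/
def rescaleDeriv (p lam : ℝ) (v' : E → ℝ → ℝ) (e : E) (x : ℝ) : ℝ :=
  lam ^ (1 / (p - 1)) * √lam * v' e (√lam * x)

variable {p lam x : ℝ} {v v' : E → ℝ → ℝ} {e : E}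

theorem rescaledSoliton_eq_rescale (p lam : ℝ) (e₁ : E) :
    rescaledSoliton p lam e₁ = rescale p lam (solitonOn p e₁) := by
  funext e x
  rw [rescaledSoliton, rescale, solitonOn, mul_ite, mul_zero]

theorem hasDerivAt_rescale (h : HasDerivAt (v e) (v' e (√lam * x)) (√lam * x)) :
    HasDerivAt (rescale p lam v e) (rescaleDeriv p lam v' e x) x :=
  ((h.comp x ((hasDerivAt_id x).const_mul √lam)).const_mul (lam ^ (1 / (p - 1)))).congr_deriv
    (by rw [rescaleDeriv, mul_one]; ring)

theorem hasDerivAt_rescaleDeriv (hlam : 0 ≤ lam) {c : ℝ}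
    (h : HasDerivAt (v' e) c (√lam * x)) :
    HasDerivAt (rescaleDeriv p lam v' e) (lam ^ (1 / (p - 1)) * lam * c) x :=
  ((h.comp x ((hasDerivAt_id x).const_mul √lam)).const_mul
    (lam ^ (1 / (p - 1)) * √lam)).congr_deriv (by
      linear_combination lam ^ (1 / (p - 1)) * c * Real.mul_self_sqrt hlam)

end Rescale

variable {V E : Type*}

/-- The graph with all edge lengths multiplied by `s`. -/
@[simps]
def scale (G : MetricGraph V E) {s : ℝ} (hs : 0 < s) : MetricGraph V E where
  src := G.src
  tgt := G.tgt
  len e := s * G.len e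
  len_pos e := mul_pos hs (G.len_pos e)

variable {G : MetricGraph V E}

theorem IsPendantEdge.of_degree_eq_one [Finite E] {e₁ : E} (h : G.degree (G.src e₁) = 1) :
    G.IsPendantEdge e₁ := by
  have hsrc : 0 < {e | G.src e = G.src e₁}.ncard := (ncard_pos (toFinite _)).2 ⟨e₁, rfl⟩
  unfold degree at h
  have hsrc_one : {e | G.src e = G.src e₁}.ncard = 1 := by omega
  have htgt_zero : {e | G.tgt e = G.src e₁}.ncard = 0 := by omega
  refine ⟨fun e he => (ncard_le_one_iff (toFinite _)).1 hsrc_one.le he rfl, fun e he => ?_⟩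
  exact ((ncard_eq_zero (toFinite _)).1 htgt_zero).subset he

theorem mul_mem_Icc_scale_len {s : ℝ} (hs : 0 < s) {e : E} {x : ℝ} (hx : x ∈ G.edge e) :
    s * x ∈ Icc 0 ((G.scale hs).len e) :=
  ⟨mul_nonneg hs.le hx.1, mul_le_mul_of_nonneg_left hx.2 hs.le⟩

theorem uniqueDiffOn_edge (G : MetricGraph V E) (e : E) : UniqueDiffOn ℝ (G.edge e) :=
  uniqueDiffOn_Icc (G.len_pos e)

theorem eventually_sqrt_mul_len_ge_and_exp_le [Finite E] (G : MetricGraph V E) (e₁ : E)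
    (L C : ℝ) {η : ℝ} (hη : 0 < η) : ∀ᶠ lam : ℝ in atTop, (∀ e, L ≤ √lam * G.len e) ∧
      C * Real.exp (-(√lam * G.len e₁)) ≤ η := by
  have hlen : ∀ e, Tendsto (fun lam : ℝ => √lam * G.len e) atTop atTop := fun e =>
    Real.tendsto_sqrt_atTop.atTop_mul_const (G.len_pos e)
  have hexp : Tendsto (fun lam : ℝ => C * Real.exp (-(√lam * G.len e₁))) atTop (𝓝 0) := by
    simpa using (Real.tendsto_exp_neg_atTop_nhds_zero.comp (hlen e₁)).const_mul C
  exact (eventually_all.2 fun e => (hlen e).eventually_ge_atTop L).and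
    (hexp.eventually (ge_mem_nhds hη))

variable [Fintype E]

theorem l2Norm_pos [Nonempty E] {u : E → ℝ → ℝ} (hu : ∀ e, ContinuousOn (u e) (G.edge e))
    (hpos : ∀ e, ∀ x ∈ G.edge e, 0 < u e x) : 0 < G.l2Norm u := by
  refine Real.sqrt_pos.2 (Finset.sum_pos (fun e _ => ?_) Finset.univ_nonempty)
  rw [setIntegral_Ioo_eq_intervalIntegral (G.len_pos e).le]
  exact intervalIntegral.intervalIntegral_pos_of_pos_on
    (((hu e).pow 2).intervalIntegrable_of_Icc (G.len_pos e).le)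
    (fun x hx => pow_pos (hpos e x (Ioo_subset_Icc_self hx)) 2) (G.len_pos e)

namespace IsTransmissionSolution

variable {p lam : ℝ} {v v' : E → ℝ → ℝ} (hlam : 0 < lam)
  (h : (G.scale (Real.sqrt_pos.2 hlam)).IsTransmissionSolution p v v')
include h

theorem hasDerivAt_rescale (e : E) (x : ℝ) :
    HasDerivAt (rescale p lam v e) (rescaleDeriv p lam v' e x) x :=
  MetricGraph.hasDerivAt_rescale (h.hasDerivAt e _)

theorem hasDerivAt_rescaleDeriv {e : E} {x : ℝ} (hx : x ∈ G.edge e) :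
    HasDerivAt (rescaleDeriv p lam v' e)
      (lam ^ (1 / (p - 1)) * lam * (v e (√lam * x) - max (v e (√lam * x)) 0 ^ p)) x :=
  MetricGraph.hasDerivAt_rescaleDeriv hlam.le
    (h.hasDerivAt' e _ (mul_mem_Icc_scale_len (Real.sqrt_pos.2 hlam) hx))

theorem continuousOn_rescaleDeriv (e : E) :
    ContinuousOn (rescaleDeriv p lam v' e) (G.edge e) :=
  HasDerivAt.continuousOn fun _ hx => h.hasDerivAt_rescaleDeriv hlam hx

theorem memH1_rescale : G.MemH1 (rescale p lam v) := by
  obtain ⟨val, hval⟩ := h.vertex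
  refine ⟨⟨fun e => HasDerivAt.continuousOn fun x _ => h.hasDerivAt_rescale hlam e x,
    fun w => lam ^ (1 / (p - 1)) * val w, fun e => ⟨?_, ?_⟩⟩, fun e =>
      memH1Interval_of_hasDerivAt (G.len_pos e).le (fun x _ => h.hasDerivAt_rescale hlam e x)
        (h.continuousOn_rescaleDeriv hlam e)⟩
  · rw [rescale, mul_zero, (hval e).1, scale_src]
  · exact congrArg (lam ^ (1 / (p - 1)) * ·) (hval e).2

theorem contDiffOn_rescale (hp : 0 ≤ p) (e : E) :
    ContDiffOn ℝ 2 (rescale p lam v e) (G.edge e) := by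
  have hv : Continuous (v e) :=
    continuous_iff_continuousAt.2 fun x => (h.hasDerivAt e x).continuousAt
  exact contDiffOn_two_of_hasDerivWithinAt (G.uniqueDiffOn_edge e)
    (fun x _ => (h.hasDerivAt_rescale hlam e x).hasDerivWithinAt)
    (fun x hx => (h.hasDerivAt_rescaleDeriv hlam hx).hasDerivWithinAt)
    (continuous_const.mul ((hv.sub ((continuous_max_zero_rpow hp).comp hv)).comp
      (continuous_const.mul continuous_id))).continuousOn

theorem equation_rescale (hp : 1 < p) {e : E} {x : ℝ} (hx : x ∈ G.edge e)
    (hpos : 0 < v e (√lam * x)) :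
    -iteratedDerivWithin 2 (rescale p lam v e) (G.edge e) x + lam * rescale p lam v e x =
      |rescale p lam v e x| ^ (p - 1) * rescale p lam v e x := by
  have hμ : 0 < lam ^ (1 / (p - 1)) := Real.rpow_pos_of_pos hlam _
  have hμp : (lam ^ (1 / (p - 1))) ^ (p - 1) = lam := by
    rw [← Real.rpow_mul hlam.le, one_div_mul_cancel (by linarith), Real.rpow_one]
  rw [iteratedDerivWithin_two_of_hasDerivWithinAt (G.uniqueDiffOn_edge e)
    (fun x _ => (h.hasDerivAt_rescale hlam e x).hasDerivWithinAt)
    (fun x hx => (h.hasDerivAt_rescaleDeriv hlam hx).hasDerivWithinAt) hx, rescale,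
    max_eq_left hpos.le, abs_of_pos (mul_pos hμ hpos), Real.mul_rpow hμ.le hpos.le, hμp,
    Real.rpow_sub_one hpos.ne']
  field_simp
  ring

theorem kirchhoffAt_rescale (w : V) : G.KirchhoffAt (rescale p lam v) w := by
  have hsrc : ∀ e, G.outDerivSrc (rescale p lam v) e = lam ^ (1 / (p - 1)) * √lam * v' e 0 :=
    fun e => by
      rw [outDerivSrc, (h.hasDerivAt_rescale hlam e 0).hasDerivWithinAt.derivWithin
        (G.uniqueDiffOn_edge e 0 (G.zero_mem_Icc_len e)), rescaleDeriv, mul_zero]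
  have htgt : ∀ e, G.outDerivTgt (rescale p lam v) e =
      lam ^ (1 / (p - 1)) * √lam * -v' e (√lam * G.len e) := fun e => by
    rw [outDerivTgt, (h.hasDerivAt_rescale hlam e _).hasDerivWithinAt.derivWithin
      (G.uniqueDiffOn_edge e _ (G.len_mem_Icc_len e)), rescaleDeriv, mul_neg]
  rw [KirchhoffAt, Finset.sum_congr rfl fun e _ => hsrc e, Finset.sum_congr rfl fun e _ => htgt e,
    ← Finset.mul_sum, ← Finset.mul_sum, ← mul_add]
  exact mul_eq_zero_of_right _ (h.kirchhoff w)

theorem isPositiveSolution_rescale (hp : 1 < p)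
    (hpos : ∀ e, ∀ x ∈ G.edge e, 0 < v e (√lam * x)) :
    G.IsPositiveSolution p lam (G.l2Norm (rescale p lam v)) (rescale p lam v) where
  memH1 := h.memH1_rescale hlam
  contDiffOn := h.contDiffOn_rescale hlam (by linarith)
  equation e x hx := h.equation_rescale hlam hp hx (hpos e x hx)
  kirchhoff := h.kirchhoffAt_rescale hlam
  l2Norm_eq := rfl
  pos e x hx := mul_pos (Real.rpow_pos_of_pos hlam _) (hpos e x hx)

end IsTransmissionSolution

/-- `u`, with derivative `u'` along the edges, is within `C exp (-√lam * len e₁)` of the soliton on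
`e₁` after rescaling, together with its derivative. -/
structure IsNearSoliton (G : MetricGraph V E) (p lam C : ℝ) (e₁ : E) (u u' : E → ℝ → ℝ) :
    Prop where
  hasDerivAt : ∀ e, ∀ x ∈ G.edge e, HasDerivAt (u e) (u' e x) x
  continuousOn_deriv : ∀ e, ContinuousOn (u' e) (G.edge e)
  abs_sub_le : ∀ e, ∀ x ∈ G.edge e, |u e x - rescale p lam (solitonOn p e₁) e x| ≤
    lam ^ (1 / (p - 1)) * (C * Real.exp (-(√lam * G.len e₁)))
  abs_deriv_sub_le : ∀ e, ∀ x ∈ G.edge e, |u' e x - rescaleDeriv p lam (solitonOnDeriv p e₁) e x| ≤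
    lam ^ (1 / (p - 1)) * √lam * (C * Real.exp (-(√lam * G.len e₁)))

theorem IsNearSoliton.of_isTransmissionSolution {p lam C : ℝ} (hlam : 0 < lam) {e₁ : E}
    {v v' : E → ℝ → ℝ} (h : (G.scale (Real.sqrt_pos.2 hlam)).IsTransmissionSolution p v v')
    (hclose : ∀ e, ∀ x ∈ Icc 0 (√lam * G.len e),
      |v e x - solitonOn p e₁ e x| ≤ C * Real.exp (-(√lam * G.len e₁)) ∧
        |v' e x - solitonOnDeriv p e₁ e x| ≤ C * Real.exp (-(√lam * G.len e₁))) :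
    G.IsNearSoliton p lam C e₁ (rescale p lam v) (rescaleDeriv p lam v') where
  hasDerivAt e x _ := h.hasDerivAt_rescale hlam e x
  continuousOn_deriv := h.continuousOn_rescaleDeriv hlam
  abs_sub_le e x hx := by
    have hμ : 0 ≤ lam ^ (1 / (p - 1)) := Real.rpow_nonneg hlam.le _
    rw [rescale, rescale, ← mul_sub, abs_mul, abs_of_nonneg hμ]
    exact mul_le_mul_of_nonneg_left
      (hclose e _ (mul_mem_Icc_scale_len (Real.sqrt_pos.2 hlam) hx)).1 hμ
  abs_deriv_sub_le e x hx := by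
    have hμ : 0 ≤ lam ^ (1 / (p - 1)) * √lam := by positivity
    rw [rescaleDeriv, rescaleDeriv, ← mul_sub, abs_mul, abs_of_nonneg hμ]
    exact mul_le_mul_of_nonneg_left
      (hclose e _ (mul_mem_Icc_scale_len (Real.sqrt_pos.2 hlam) hx)).2 hμ

theorem exists_peaked_solution (hconn : G.IsConnected) {p : ℝ} (hp : 1 < p) {e₁ : E}
    (he₁ : G.IsPendantEdge e₁) :
    ∃ lam₀ C : ℝ, 1 ≤ lam₀ ∧ 0 < C ∧ ∀ lam, lam₀ < lam → ∃ u u' : E → ℝ → ℝ,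
      G.IsPositiveSolution p lam (G.l2Norm u) u ∧ 0 < G.l2Norm u ∧
      G.IsNearSoliton p lam C e₁ u u' ∧
      ∀ e, ∀ x ∈ G.edge e, (e, x) ≠ (e₁, 0) → u e x < u e₁ 0 := by
  obtain ⟨L, C, hC, hexists⟩ := exists_solution_near_soliton V E hp
  obtain ⟨η, hη, hpeak⟩ := exists_peak_threshold V E hp
  obtain ⟨M, hM⟩ := eventually_atTop.1 (G.eventually_sqrt_mul_len_ge_and_exp_le e₁ L C hη)
  refine ⟨max M 1, C, le_max_right _ _, hC, fun lam hlam => ?_⟩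
  obtain ⟨hL, hsmall⟩ := hM lam ((le_max_left _ _).trans hlam.le)
  have hlam0 : 0 < lam := one_pos.trans ((le_max_right _ _).trans_lt hlam)
  have hs : 0 < √lam := Real.sqrt_pos.2 hlam0
  have he₁' : (G.scale hs).IsPendantEdge e₁ := ⟨he₁.eq_of_src_eq, he₁.tgt_ne⟩
  obtain ⟨v, v', hv, hclose⟩ := hexists (G.scale hs) e₁ hL he₁'
  obtain ⟨hv0, hmax⟩ := hpeak (G.scale hs) e₁ he₁' v v' hv
    fun e x hx => (hclose e x hx).1.trans hsmall
  have hsol := hv.isPositiveSolution_rescale hlam0 hp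
    fun e x hx => hv.pos hp hconn hv0 (mul_mem_Icc_scale_len hs hx)
  have : Nonempty E := ⟨e₁⟩
  refine ⟨rescale p lam v, rescaleDeriv p lam v', hsol, l2Norm_pos hsol.memH1.1.1 hsol.pos,
    .of_isTransmissionSolution hlam0 hv hclose, fun e x hx hne => ?_⟩
  have hlt : v e (√lam * x) < v e₁ 0 := hmax e _ (mul_mem_Icc_scale_len hs hx) fun h =>
    hne (Prod.ext (Prod.mk.inj h).1 ((mul_eq_zero.1 (Prod.mk.inj h).2).resolve_left hs.ne'))
  rw [rescale, rescale, mul_zero]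
  exact mul_lt_mul_of_pos_left hlt (Real.rpow_pos_of_pos hlam0 _)

end MetricGraph

/-! ### The mass -/

theorem integrableOn_soliton_sq {p : ℝ} (hp : 1 < p) :
    IntegrableOn (fun x => soliton p x ^ 2) (Ioi 0) := by
  set K := ((p + 1) / 2) ^ (1 / (p - 1)) * (2 : ℝ) ^ (1 / ((p - 1) / 2))
  have hexp : IntegrableOn (fun x : ℝ => K ^ 2 * Real.exp (-2 * x)) (Ioi 0) :=
    (integrableOn_exp_mul_Ioi (by norm_num) 0).const_mul _
  refine hexp.mono' ((continuous_soliton hp).pow 2).aestronglyMeasurable (.of_forall fun x => ?_)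
  rw [Real.norm_eq_abs, abs_of_nonneg (sq_nonneg _)]
  calc soliton p x ^ 2 ≤ (K * Real.exp (-x)) ^ 2 :=
        pow_le_pow_left₀ (soliton_pos hp x).le (soliton_le_exp hp x) 2
    _ = K ^ 2 * Real.exp (-2 * x) := by
        rw [mul_pow, ← Real.exp_nat_mul, Nat.cast_ofNat, mul_neg, neg_mul]

theorem rpow_one_div_sub_one_sq {p lam : ℝ} (hp : p ≠ 1) (hlam : 0 < lam) :
    (lam ^ (1 / (p - 1))) ^ 2 = lam ^ ((5 - p) / (2 * (p - 1))) * √lam := by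
  have hp' : p - 1 ≠ 0 := sub_ne_zero.2 hp
  rw [Real.sqrt_eq_rpow, ← Real.rpow_natCast, ← Real.rpow_mul hlam.le, ← Real.rpow_add hlam]
  congr 1
  push_cast
  field_simp
  ring

theorem tendsto_sqrt_mul_exp_neg_sqrt_mul {a : ℝ} (ha : 0 < a) :
    Tendsto (fun x : ℝ => √x * Real.exp (-(√x * a))) atTop (𝓝 0) := by
  have h := ((Real.tendsto_pow_mul_exp_neg_atTop_nhds_zero 1).comp
    (Real.tendsto_sqrt_atTop.atTop_mul_const ha)).const_mul a⁻¹
  rw [mul_zero] at h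
  refine h.congr fun x => ?_
  simp only [Function.comp, pow_one]
  field_simp

theorem abs_sq_sub_sq_le {x y a b : ℝ} (hxy : |x - y| ≤ a) (hy : |y| ≤ b) :
    |x ^ 2 - y ^ 2| ≤ a * (a + 2 * b) := by
  have hsum : |x + y| ≤ a + 2 * b := by
    rw [abs_le] at *
    constructor <;> linarith
  rw [sq_sub_sq, abs_mul, mul_comm]
  exact mul_le_mul hxy hsum (abs_nonneg _) ((abs_nonneg _).trans hxy)

namespace MetricGraph

variable {V E : Type*} [Fintype E] {G : MetricGraph V E}

theorem l2Norm_sq (u : E → ℝ → ℝ) : G.l2Norm u ^ 2 = ∑ e, ∫ x in 0..G.len e, u e x ^ 2 := by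
  rw [l2Norm, Real.sq_sqrt (Finset.sum_nonneg fun e _ => integral_nonneg fun x => sq_nonneg _)]
  exact Finset.sum_congr rfl fun e _ => setIntegral_Ioo_eq_intervalIntegral (G.len_pos e).le _

theorem abs_l2Norm_sq_sub_le {u w : E → ℝ → ℝ} {a b : ℝ}
    (hu : ∀ e, ContinuousOn (u e) (G.edge e)) (hw : ∀ e, ContinuousOn (w e) (G.edge e))
    (hd : ∀ e, ∀ x ∈ G.edge e, |u e x - w e x| ≤ a) (hb : ∀ e, ∀ x ∈ G.edge e, |w e x| ≤ b) :
    |G.l2Norm u ^ 2 - G.l2Norm w ^ 2| ≤ (∑ e, G.len e) * (a * (a + 2 * b)) := by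
  rw [l2Norm_sq, l2Norm_sq, ← Finset.sum_sub_distrib, Finset.sum_mul]
  refine (Finset.abs_sum_le_sum_abs _ _).trans (Finset.sum_le_sum fun e _ => ?_)
  have hlen := (G.len_pos e).le
  rw [← intervalIntegral.integral_sub (f := fun x => u e x ^ 2) (g := fun x => w e x ^ 2)
    (((hu e).pow 2).intervalIntegrable_of_Icc hlen)
    (((hw e).pow 2).intervalIntegrable_of_Icc hlen)]
  have h := intervalIntegral.norm_integral_le_of_norm_le_const (a := 0) (b := G.len e)
    (f := fun x => u e x ^ 2 - w e x ^ 2) (C := a * (a + 2 * b)) fun x hx => by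
      have hx : x ∈ G.edge e := Ioc_subset_Icc_self (uIoc_of_le hlen ▸ hx)
      exact abs_sq_sub_sq_le (hd e x hx) (hb e x hx)
  rwa [sub_zero, abs_of_pos (G.len_pos e), mul_comm, Real.norm_eq_abs] at h

theorem l2Norm_sq_rescale_solitonOn {p lam : ℝ} (hp : p ≠ 1) (hlam : 0 < lam) (e₁ : E) :
    G.l2Norm (rescale p lam (solitonOn p e₁)) ^ 2 =
      lam ^ ((5 - p) / (2 * (p - 1))) * ∫ x in 0..√lam * G.len e₁, soliton p x ^ 2 := by
  have hs : √lam ≠ 0 := (Real.sqrt_pos.2 hlam).ne'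
  rw [l2Norm_sq, Finset.sum_eq_single e₁ (fun e _ he => by simp [rescale, solitonOn_of_ne p he])
    (fun h => absurd (Finset.mem_univ _) h)]
  simp only [rescale, solitonOn_self, mul_pow, rpow_one_div_sub_one_sq hp hlam]
  rw [intervalIntegral.integral_const_mul,
    intervalIntegral.integral_comp_mul_left (fun x => soliton p x ^ 2) hs, mul_zero, smul_eq_mul,
    mul_assoc, mul_inv_cancel_left₀ hs]

omit [Fintype E] in
theorem continuous_rescale_solitonOn {p : ℝ} (hp : 1 < p) (lam : ℝ) (e₁ e : E) :
    Continuous (rescale p lam (solitonOn p e₁) e) :=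
  continuous_const.mul ((continuous_solitonOn hp e₁ e).comp (continuous_const.mul continuous_id))

namespace IsNearSoliton

theorem abs_l2Norm_sq_sub_le {p lam C : ℝ} (hp : 1 < p) (hlam : 0 < lam) (hC : 0 ≤ C) {e₁ : E}
    {u u' : E → ℝ → ℝ} (h : G.IsNearSoliton p lam C e₁ u u') :
    |G.l2Norm u ^ 2 - lam ^ ((5 - p) / (2 * (p - 1))) *
        ∫ x in 0..√lam * G.len e₁, soliton p x ^ 2| ≤
      lam ^ ((5 - p) / (2 * (p - 1))) * ((∑ e, G.len e) * (C * (C + 2 * soliton p 0)) *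
        (√lam * Real.exp (-(√lam * G.len e₁)))) := by
  set μ := lam ^ (1 / (p - 1)) with hμ
  set η := Real.exp (-(√lam * G.len e₁))
  have hμ0 : 0 ≤ μ := Real.rpow_nonneg hlam.le _
  have hη1 : η ≤ 1 := Real.exp_le_one_iff.2
    (neg_nonpos.2 (mul_nonneg (Real.sqrt_nonneg _) (G.len_pos e₁).le))
  have hT : 0 ≤ ∑ e, G.len e := Finset.sum_nonneg fun e _ => (G.len_pos e).le
  have := (soliton_pos hp 0).le
  have hsoliton : ∀ e x, |rescale p lam (solitonOn p e₁) e x| ≤ μ * soliton p 0 := fun e x => by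
    have hmem := solitonOn_mem_Icc hp e₁ e (√lam * x)
    rw [rescale, abs_of_nonneg (mul_nonneg hμ0 hmem.1)]
    exact mul_le_mul_of_nonneg_left hmem.2 hμ0
  rw [← l2Norm_sq_rescale_solitonOn hp.ne' hlam]
  calc _ ≤ (∑ e, G.len e) * (μ * (C * η) * (μ * (C * η) + 2 * (μ * soliton p 0))) :=
        MetricGraph.abs_l2Norm_sq_sub_le (fun e => HasDerivAt.continuousOn (h.hasDerivAt e))
          (fun e => (continuous_rescale_solitonOn hp lam e₁ e).continuousOn) h.abs_sub_le
          fun e x _ => hsoliton e x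
    _ = (∑ e, G.len e) * (μ ^ 2 * (C * η) * (C * η + 2 * soliton p 0)) := by ring
    _ ≤ (∑ e, G.len e) * (μ ^ 2 * (C * η) * (C * 1 + 2 * soliton p 0)) := by gcongr
    _ = _ := by rw [hμ, rpow_one_div_sub_one_sq hp.ne' hlam]; ring

theorem mass_asymptotics {p lam₀ C : ℝ} (hp : 1 < p) (hlam₀ : 0 ≤ lam₀) (hC : 0 ≤ C) {e₁ : E}
    {u u' : ℝ → E → ℝ → ℝ}
    (h : ∀ lam, lam₀ < lam → G.IsNearSoliton p lam C e₁ (u lam) (u' lam)) :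
    (fun lam : ℝ => G.l2Norm (u lam) ^ 2
        - (∫ x in Ioi (0 : ℝ), soliton p x ^ 2) * lam ^ ((5 - p) / (2 * (p - 1))))
      =o[atTop] fun lam : ℝ => lam ^ ((5 - p) / (2 * (p - 1))) := by
  set g : ℝ → ℝ := fun lam => lam ^ ((5 - p) / (2 * (p - 1)))
  set J : ℝ → ℝ := fun lam => ∫ x in 0..√lam * G.len e₁, soliton p x ^ 2
  set I := ∫ x in Ioi (0 : ℝ), soliton p x ^ 2
  have mul_isLittleO : ∀ r : ℝ → ℝ, Tendsto r atTop (𝓝 0) →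
      (fun lam => g lam * r lam) =o[atTop] g := fun r hr => by
    simpa using (Asymptotics.isBigO_refl g atTop).mul_isLittleO
      ((Asymptotics.isLittleO_one_iff ℝ).2 hr)
  have hsoliton : (fun lam => g lam * (J lam - I)) =o[atTop] g :=
    mul_isLittleO _ (tendsto_sub_nhds_zero_iff.2 (intervalIntegral_tendsto_integral_Ioi 0
      (integrableOn_soliton_sq hp) (Real.tendsto_sqrt_atTop.atTop_mul_const (G.len_pos e₁))))
  have hcorrection : (fun lam => G.l2Norm (u lam) ^ 2 - g lam * J lam) =o[atTop] g := by
    refine (Asymptotics.IsBigO.of_bound 1 ?_).trans_isLittleO (mul_isLittleO _ (by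
      simpa using (tendsto_sqrt_mul_exp_neg_sqrt_mul (G.len_pos e₁)).const_mul
        ((∑ e, G.len e) * (C * (C + 2 * soliton p 0)))))
    filter_upwards [eventually_gt_atTop lam₀] with lam hlam
    rw [one_mul]
    exact ((h lam hlam).abs_l2Norm_sq_sub_le hp (hlam₀.trans_lt hlam) hC).trans (le_abs_self _)
  refine (hcorrection.add hsoliton).congr_left fun lam => ?_
  ring

end IsNearSoliton

end MetricGraph

/-! ### The remainder after the cut-off -/

theorem IsCutoff.deriv_eq_zero {l : ℝ} {χ : ℝ → ℝ} (hχ : IsCutoff l χ) {x : ℝ}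
    (hx : x ∈ Ioo 0 (l / 2)) : deriv χ x = 0 := by
  have hone : χ =ᶠ[𝓝 x] fun _ => 1 := by
    filter_upwards [Ioo_mem_nhds hx.1 hx.2] with y hy using hχ.eq_one y hy.1.le hy.2.le
  rw [hone.deriv_eq, deriv_const]

theorem exists_abs_mul_soliton_comp_mul_le {p : ℝ} (hp : 1 < p) {g : ℝ → ℝ} {a L : ℝ}
    (hg : ContinuousOn g (Icc 0 L)) (hg0 : ∀ x ∈ Ioo 0 a, g x = 0) :
    ∃ B : ℝ, 0 ≤ B ∧ ∀ s : ℝ, 0 ≤ s → ∀ x ∈ Ioo 0 L,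
      |g x| * soliton p (s * x) ≤ B * Real.exp (-(s * a)) := by
  obtain ⟨M, hM⟩ := isCompact_Icc.exists_bound_of_continuousOn hg
  set K := ((p + 1) / 2) ^ (1 / (p - 1)) * (2 : ℝ) ^ (1 / ((p - 1) / 2))
  have : 0 ≤ K := by positivity
  refine ⟨|M| * K, by positivity, fun s hs x hx => ?_⟩
  rcases lt_or_ge x a with hxa | hax
  · rw [hg0 x ⟨hx.1, hxa⟩, abs_zero, zero_mul]
    positivity
  · calc |g x| * soliton p (s * x) ≤ |M| * (K * Real.exp (-(s * x))) :=
          mul_le_mul ((hM x (Ioo_subset_Icc_self hx)).trans (le_abs_self M)) (soliton_le_exp hp _)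
            (soliton_pos hp _).le (abs_nonneg M)
      _ ≤ |M| * (K * Real.exp (-(s * a))) := by gcongr
      _ = |M| * K * Real.exp (-(s * a)) := by ring

theorem rpow_mul_exp_neg_mul_sqrt_isBigO {b : ℝ} (hb : 0 < b) (k α : ℝ) :
    (fun x : ℝ => x ^ k * Real.exp (-b * √x)) =O[atTop] fun x : ℝ => x ^ α := by
  have hexp : (fun x : ℝ => Real.exp (-b * √x)) =O[atTop] fun x : ℝ => √x ^ (2 * (α - k)) :=
    ((isLittleO_exp_neg_mul_rpow_atTop hb _).comp_tendsto Real.tendsto_sqrt_atTop).isBigO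
  refine ((Asymptotics.isBigO_refl (fun x : ℝ => x ^ k) atTop).mul hexp).congr'
    .rfl ?_
  filter_upwards [eventually_gt_atTop 0] with x hx
  rw [Real.sqrt_eq_rpow, ← Real.rpow_mul hx.le, ← Real.rpow_add hx]
  congr 1
  ring

theorem setIntegral_Ioo_sq_le {f : ℝ → ℝ} {a b c : ℝ} (hab : a ≤ b)
    (hf : ∀ x ∈ Ioo a b, |f x| ≤ c) : ∫ x in Ioo a b, f x ^ 2 ≤ (b - a) * c ^ 2 := by
  have h := norm_setIntegral_le_of_norm_le_const (μ := volume) (s := Ioo a b)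
    (f := fun x => f x ^ 2) (C := c ^ 2) (by simp) fun x hx => by
      rw [norm_pow]
      exact pow_le_pow_left₀ (abs_nonneg _) (hf x hx) 2
  rw [Real.volume_real_Ioo_of_le hab, mul_comm] at h
  exact (le_abs_self _).trans h

namespace MetricGraph

section Cutoff

variable {E : Type*} {p : ℝ} {χ : ℝ → ℝ}

/-- The derivative of `cutoffSoliton p lam χ e₁`. -/
def cutoffSolitonDeriv (p lam : ℝ) (χ : ℝ → ℝ) (e₁ e : E) (x : ℝ) : ℝ :=
  deriv χ x * rescale p lam (solitonOn p e₁) e x +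
    χ x * rescaleDeriv p lam (solitonOnDeriv p e₁) e x

theorem cutoffSoliton_eq (p lam : ℝ) (χ : ℝ → ℝ) (e₁ e : E) (x : ℝ) :
    cutoffSoliton p lam χ e₁ e x = χ x * rescale p lam (solitonOn p e₁) e x := by
  rw [cutoffSoliton, rescaledSoliton_eq_rescale]

theorem cutoffSoliton_of_ne (p lam : ℝ) (χ : ℝ → ℝ) {e₁ e : E} (he : e ≠ e₁) :
    cutoffSoliton p lam χ e₁ e = 0 :=
  funext fun x => by rw [cutoffSoliton, rescaledSoliton, if_neg he, mul_zero, Pi.zero_apply]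

theorem hasDerivAt_cutoffSoliton (hp : 1 < p) (lam : ℝ) (e₁ e : E) {x : ℝ}
    (hχ : DifferentiableAt ℝ χ x) :
    HasDerivAt (cutoffSoliton p lam χ e₁ e) (cutoffSolitonDeriv p lam χ e₁ e x) x := by
  rw [funext (cutoffSoliton_eq p lam χ e₁ e)]
  exact hχ.hasDerivAt.mul (hasDerivAt_rescale (hasDerivAt_solitonOn hp e₁ e _))

theorem continuous_cutoffSolitonDeriv (hp : 1 < p) (lam : ℝ) (hχ : ContDiff ℝ 1 χ) (e₁ e : E) :
    Continuous (cutoffSolitonDeriv p lam χ e₁ e) := by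
  have hderiv : Continuous (solitonOnDeriv p e₁ e) :=
    continuous_iff_continuousAt.2 fun x => (hasDerivAt_solitonOnDeriv hp e₁ e x).continuousAt
  exact ((hχ.continuous_deriv le_rfl).mul (continuous_rescale_solitonOn hp lam e₁ e)).add
    (hχ.continuous.mul (continuous_const.mul (hderiv.comp (continuous_const.mul continuous_id))))

end Cutoff

variable {V E : Type*} {G : MetricGraph V E}

theorem IsPendantEdge.exists_vertexVal_cutoffSoliton {e₁ : E} (he₁ : G.IsPendantEdge e₁) {l : ℝ}
    (hl : l ≤ G.len e₁) {χ : ℝ → ℝ} (hχ : IsCutoff l χ) (p lam : ℝ) :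
    ∃ val : V → ℝ, ∀ e, cutoffSoliton p lam χ e₁ e 0 = val (G.src e) ∧
      cutoffSoliton p lam χ e₁ e (G.len e) = val (G.tgt e) := by
  classical
  refine ⟨Pi.single (G.src e₁) (cutoffSoliton p lam χ e₁ e₁ 0), fun e => ?_⟩
  rw [Pi.single_eq_of_ne (he₁.tgt_ne e)]
  rcases eq_or_ne e e₁ with rfl | he
  · rw [Pi.single_eq_same, cutoffSoliton, cutoffSoliton, hχ.eq_zero _ hl, zero_mul]
    exact ⟨rfl, rfl⟩
  · rw [Pi.single_eq_of_ne fun h => he (he₁.eq_of_src_eq e h), cutoffSoliton_of_ne p lam χ he]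
    exact ⟨rfl, rfl⟩

namespace IsNearSoliton

variable {p lam C : ℝ} {e₁ : E} {u u' : E → ℝ → ℝ} {χ : ℝ → ℝ} {l : ℝ}

theorem hasDerivAt_sub_cutoffSoliton (h : G.IsNearSoliton p lam C e₁ u u') (hp : 1 < p)
    (hχ : Differentiable ℝ χ) (e : E) {x : ℝ} (hx : x ∈ G.edge e) :
    HasDerivAt ((u - cutoffSoliton p lam χ e₁) e) (u' e x - cutoffSolitonDeriv p lam χ e₁ e x) x :=
  (h.hasDerivAt e x hx).sub (hasDerivAt_cutoffSoliton hp lam e₁ e (hχ x))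

theorem continuousOn_deriv_sub_cutoffSolitonDeriv (h : G.IsNearSoliton p lam C e₁ u u')
    (hp : 1 < p) (hχ : ContDiff ℝ 1 χ) (e : E) :
    ContinuousOn (fun x => u' e x - cutoffSolitonDeriv p lam χ e₁ e x) (G.edge e) :=
  (h.continuousOn_deriv e).sub (continuous_cutoffSolitonDeriv hp lam hχ e₁ e).continuousOn

theorem memH1_sub_cutoffSoliton (h : G.IsNearSoliton p lam C e₁ u u') (hp : 1 < p)
    (he₁ : G.IsPendantEdge e₁) (hl : l ≤ G.len e₁) (hχ : IsCutoff l χ) (hu : G.MemH1 u) :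
    G.MemH1 (u - cutoffSoliton p lam χ e₁) := by
  have hd := fun e x (hx : x ∈ G.edge e) =>
    h.hasDerivAt_sub_cutoffSoliton hp (hχ.smooth.differentiable (by simp)) e hx
  obtain ⟨⟨-, val, hval⟩, -⟩ := hu
  obtain ⟨valW, hvalW⟩ := he₁.exists_vertexVal_cutoffSoliton hl hχ p lam
  exact ⟨⟨fun e => HasDerivAt.continuousOn (hd e), val - valW, fun e =>
      ⟨congrArg₂ (· - ·) (hval e).1 (hvalW e).1, congrArg₂ (· - ·) (hval e).2 (hvalW e).2⟩⟩,
    fun e => memH1Interval_of_hasDerivAt (G.len_pos e).le (hd e)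
      (h.continuousOn_deriv_sub_cutoffSolitonDeriv hp (hχ.smooth.of_le (by simp)) e)⟩

section Pointwise

variable {b b' : ℝ} {e : E} {x : ℝ} (h : G.IsNearSoliton p lam C e₁ u u') (hp : 1 < p)
  (hx : x ∈ G.edge e) (hb : |1 - χ x| * soliton p (√lam * x) ≤ b)
include h hp hx hb

theorem abs_sub_cutoffSoliton_le (hlam : 0 ≤ lam) : |u e x - cutoffSoliton p lam χ e₁ e x| ≤
    lam ^ (1 / (p - 1)) * (C * Real.exp (-(√lam * G.len e₁)) + b) := by
  set μ := lam ^ (1 / (p - 1))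
  have hμ : 0 ≤ μ := Real.rpow_nonneg hlam _
  have hcut : |(1 - χ x) * rescale p lam (solitonOn p e₁) e x| ≤ μ * b := by
    rw [rescale, mul_left_comm, abs_mul, abs_mul, abs_of_nonneg hμ]
    exact mul_le_mul_of_nonneg_left ((mul_le_mul_of_nonneg_left
      (abs_solitonOn_le_soliton hp e₁ e _) (abs_nonneg _)).trans hb) hμ
  calc |u e x - cutoffSoliton p lam χ e₁ e x|
      = |(u e x - rescale p lam (solitonOn p e₁) e x) +
          (1 - χ x) * rescale p lam (solitonOn p e₁) e x| := by
        rw [cutoffSoliton_eq]; congr 1; ring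
    _ ≤ μ * (C * Real.exp (-(√lam * G.len e₁))) + μ * b :=
        (abs_add_le _ _).trans (add_le_add (h.abs_sub_le e x hx) hcut)
    _ = _ := (mul_add _ _ _).symm

theorem abs_deriv_sub_cutoffSolitonDeriv_le (hb' : |deriv χ x| * soliton p (√lam * x) ≤ b')
    (hlam : 1 ≤ lam) : |u' e x - cutoffSolitonDeriv p lam χ e₁ e x| ≤
      lam ^ (1 / (p - 1)) * √lam * (C * Real.exp (-(√lam * G.len e₁)) + b + b') := by
  set μ := lam ^ (1 / (p - 1))
  have hμ : 0 ≤ μ := Real.rpow_nonneg (by linarith) _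
  have hμs : μ ≤ μ * √lam := le_mul_of_one_le_right hμ (Real.one_le_sqrt.2 hlam)
  have hcut : |(1 - χ x) * rescaleDeriv p lam (solitonOnDeriv p e₁) e x| ≤ μ * √lam * b := by
    rw [rescaleDeriv, mul_left_comm, abs_mul, abs_mul (1 - χ x), abs_of_nonneg (hμ.trans hμs)]
    exact mul_le_mul_of_nonneg_left ((mul_le_mul_of_nonneg_left
      (abs_solitonOnDeriv_le_soliton hp e₁ e _) (abs_nonneg _)).trans hb) (hμ.trans hμs)
  have hcut' : |deriv χ x * rescale p lam (solitonOn p e₁) e x| ≤ μ * √lam * b' := by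
    rw [rescale, mul_left_comm, abs_mul, abs_mul, abs_of_nonneg hμ]
    exact mul_le_mul hμs ((mul_le_mul_of_nonneg_left
      (abs_solitonOn_le_soliton hp e₁ e _) (abs_nonneg _)).trans hb') (by positivity)
        (hμ.trans hμs)
  calc |u' e x - cutoffSolitonDeriv p lam χ e₁ e x|
      = |(u' e x - rescaleDeriv p lam (solitonOnDeriv p e₁) e x) +
          (1 - χ x) * rescaleDeriv p lam (solitonOnDeriv p e₁) e x -
          deriv χ x * rescale p lam (solitonOn p e₁) e x| := by
        rw [cutoffSolitonDeriv]; congr 1; ring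
    _ ≤ μ * √lam * (C * Real.exp (-(√lam * G.len e₁))) + μ * √lam * b + μ * √lam * b' :=
        (abs_sub _ _).trans (add_le_add ((abs_add_le _ _).trans
          (add_le_add (h.abs_deriv_sub_le e x hx) hcut)) hcut')
    _ = _ := by ring

end Pointwise

end IsNearSoliton

variable [Fintype E]

theorem lamNorm_le {lam a : ℝ} (hlam : 0 ≤ lam) (ha : 0 ≤ a) {φ φ' : E → ℝ → ℝ}
    (hd : ∀ e, ∀ x ∈ G.edge e, HasDerivAt (φ e) (φ' e x) x)
    (hc : ∀ e, ContinuousOn (φ' e) (G.edge e))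
    (hφ : ∀ e, ∀ x ∈ Ioo 0 (G.len e), |φ e x| ≤ a)
    (hφ' : ∀ e, ∀ x ∈ Ioo 0 (G.len e), |φ' e x| ≤ √lam * a) :
    G.lamNorm lam φ ≤ √(2 * ∑ e, G.len e) * (√lam * a) := by
  have sum_integral_sq_le : ∀ (f : E → ℝ → ℝ) (c : ℝ),
      (∀ e, ∀ x ∈ Ioo 0 (G.len e), |f e x| ≤ c) →
        ∑ e, ∫ x in Ioo 0 (G.len e), f e x ^ 2 ≤ (∑ e, G.len e) * c ^ 2 := fun f c hf => by
    rw [Finset.sum_mul]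
    refine Finset.sum_le_sum fun e _ => ?_
    simpa using setIntegral_Ioo_sq_le (G.len_pos e).le (hf e)
  have hweak : ∀ e, ∫ x in Ioo 0 (G.len e), weakDeriv (G.len e) (φ e) x ^ 2 =
      ∫ x in Ioo 0 (G.len e), φ' e x ^ 2 := fun e =>
    integral_congr_ae ((weakDeriv_ae_eq (isWeakDerivL2_of_hasDerivAt (G.len_pos e).le (hd e)
      (hc e))).fun_comp (· ^ 2))
  have hT : 0 ≤ ∑ e, G.len e := Finset.sum_nonneg fun e _ => (G.len_pos e).le
  rw [lamNorm, Finset.sum_congr rfl fun e _ => hweak e,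
    ← Real.sqrt_sq (show 0 ≤ √lam * a by positivity), ← Real.sqrt_mul (by positivity)]
  refine Real.sqrt_le_sqrt ?_
  calc _ ≤ (∑ e, G.len e) * (√lam * a) ^ 2 + lam * ((∑ e, G.len e) * a ^ 2) :=
        add_le_add (sum_integral_sq_le φ' _ hφ')
          (mul_le_mul_of_nonneg_left (sum_integral_sq_le φ _ hφ) hlam)
    _ = 2 * (∑ e, G.len e) * (√lam * a) ^ 2 := by rw [mul_pow, Real.sq_sqrt hlam]; ring

namespace IsNearSoliton

variable {p C : ℝ} {e₁ : E} {χ : ℝ → ℝ} {l : ℝ}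

theorem exists_lamNorm_sub_cutoffSoliton_le (G : MetricGraph V E) (hp : 1 < p) (hC : 0 ≤ C)
    (hl : 0 ≤ l) (hl₁ : l ≤ G.len e₁) (hχ : IsCutoff l χ) :
    ∃ B : ℝ, ∀ lam, 1 ≤ lam → ∀ u u', G.IsNearSoliton p lam C e₁ u u' →
      G.lamNorm lam (u - cutoffSoliton p lam χ e₁) ≤
        B * (lam ^ (1 / (p - 1)) * √lam * Real.exp (-(√lam * (l / 2)))) := by
  have hdχ : Continuous (deriv χ) := hχ.smooth.continuous_deriv (by simp)
  obtain ⟨B, hB, hcut⟩ := exists_abs_mul_soliton_comp_mul_le hp (g := fun x => 1 - χ x)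
    (L := ∑ e, G.len e) (continuous_const.sub hχ.smooth.continuous).continuousOn
      fun x hx => sub_eq_zero.2 (hχ.eq_one x hx.1.le hx.2.le).symm
  obtain ⟨B', hB', hcut'⟩ := exists_abs_mul_soliton_comp_mul_le hp (L := ∑ e, G.len e)
    hdχ.continuousOn fun x hx => hχ.deriv_eq_zero hx
  refine ⟨√(2 * ∑ e, G.len e) * (C + B + B'), fun lam hlam u u' h => ?_⟩
  have hlam0 : 0 ≤ lam := by linarith
  set μ := lam ^ (1 / (p - 1))
  set η := Real.exp (-(√lam * (l / 2)))
  have hμ0 : 0 ≤ μ := Real.rpow_nonneg hlam0 _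
  have hη : C * Real.exp (-(√lam * G.len e₁)) ≤ C * η :=
    mul_le_mul_of_nonneg_left (Real.exp_le_exp.2 (neg_le_neg (by gcongr; linarith))) hC
  have hBη : 0 ≤ B' * η := mul_nonneg hB' (Real.exp_nonneg _)
  have hsum : C * Real.exp (-(√lam * G.len e₁)) + B * η + B' * η ≤ (C + B + B') * η := by
    linarith
  have hIoo : ∀ e, Ioo 0 (G.len e) ⊆ Ioo 0 (∑ e, G.len e) := fun e => Ioo_subset_Ioo_right
    (Finset.single_le_sum (fun e _ => (G.len_pos e).le) (Finset.mem_univ e))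
  have hle := lamNorm_le (a := μ * ((C + B + B') * η)) hlam0 (by positivity)
    (fun e x hx => h.hasDerivAt_sub_cutoffSoliton hp (hχ.smooth.differentiable (by simp)) e hx)
    (h.continuousOn_deriv_sub_cutoffSolitonDeriv hp (hχ.smooth.of_le (by simp)))
    (fun e x hx => (h.abs_sub_cutoffSoliton_le hp (Ioo_subset_Icc_self hx)
      (hcut _ (Real.sqrt_nonneg _) x (hIoo e hx)) hlam0).trans
        (mul_le_mul_of_nonneg_left (by linarith) hμ0))
    (fun e x hx => (h.abs_deriv_sub_cutoffSolitonDeriv_le hp (Ioo_subset_Icc_self hx)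
      (hcut _ (Real.sqrt_nonneg _) x (hIoo e hx))
      (hcut' _ (Real.sqrt_nonneg _) x (hIoo e hx)) hlam).trans
        ((mul_le_mul_of_nonneg_left hsum (by positivity)).trans_eq (by ring)))
  exact hle.trans_eq (by ring)

theorem lamNorm_sub_cutoffSoliton_isBigO {lam₀ : ℝ} (hp : 1 < p) (hlam₀ : 1 ≤ lam₀) (hC : 0 ≤ C)
    (hl : 0 < l) (hl₁ : l ≤ G.len e₁) (hχ : IsCutoff l χ) {u u' : ℝ → E → ℝ → ℝ}
    (h : ∀ lam, lam₀ < lam → G.IsNearSoliton p lam C e₁ (u lam) (u' lam)) (α : ℝ) :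
    (fun lam : ℝ => G.lamNorm lam (u lam - cutoffSoliton p lam χ e₁)) =O[atTop]
      fun lam : ℝ => lam ^ α := by
  obtain ⟨B, hB⟩ := exists_lamNorm_sub_cutoffSoliton_le G hp hC hl.le hl₁ hχ
  refine (Asymptotics.IsBigO.of_bound B ?_).trans
    (rpow_mul_exp_neg_mul_sqrt_isBigO (half_pos hl) (1 / (p - 1) + 1 / 2) α)
  filter_upwards [eventually_gt_atTop lam₀] with lam hlam
  have hlam0 : 0 < lam := by linarith
  rw [Real.norm_of_nonneg (show 0 ≤ G.lamNorm lam _ from Real.sqrt_nonneg _),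
    Real.norm_of_nonneg (by positivity),
    Real.rpow_add hlam0, ← Real.sqrt_eq_rpow, neg_mul, mul_comm (l / 2)]
  exact hB lam (by linarith) _ _ (h lam hlam)

end IsNearSoliton

end MetricGraph

end

theorem mainTheorem3 {V E : Type*} [Finite V] [Fintype E] (G : MetricGraph V E)
    (hconn : G.IsConnected) (p : ℝ) (hp : 1 < p)
    (v₁ : V) (hdeg : G.degree v₁ = 1) (e₁ : E) (he₁ : G.src e₁ = v₁)
    (l : ℝ) (hl : 0 < l) (hl₁ : l < G.len e₁) (χ : ℝ → ℝ) (hχ : IsCutoff l χ) :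
    ∃ (lam₀ : ℝ) (u φ : ℝ → E → ℝ → ℝ) (ρ : ℝ → ℝ),
      0 < lam₀ ∧
      (∀ lam : ℝ, lam₀ < lam →
        0 < ρ lam ∧
        G.IsPositiveSolution p lam (ρ lam) (u lam) ∧
        G.MemH1 (φ lam) ∧
        u lam = cutoffSoliton p lam χ e₁ + φ lam ∧
        -- the maximum over the graph is attained at `v₁` only
        (∀ e, ∀ x ∈ G.edge e, (e, x) ≠ (e₁, 0) → u lam e x < u lam e₁ 0)) ∧
      (∀ α : ℝ, 0 < α →
        (fun lam : ℝ => G.lamNorm lam (φ lam)) =O[atTop] (fun lam : ℝ => lam ^ (-α))) ∧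
      (fun lam : ℝ => ρ lam ^ 2
          - (∫ x in Ioi (0 : ℝ), soliton p x ^ 2) * lam ^ ((5 - p) / (2 * (p - 1))))
        =o[atTop] (fun lam : ℝ => lam ^ ((5 - p) / (2 * (p - 1)))) := by
  subst he₁
  have he₁ := MetricGraph.IsPendantEdge.of_degree_eq_one hdeg
  obtain ⟨lam₀, C, hlam₀, hC, hex⟩ := MetricGraph.exists_peaked_solution hconn hp he₁
  choose! u u' hsol hρ hnear hmax using hex
  refine ⟨lam₀, u, fun lam => u lam - cutoffSoliton p lam χ e₁, fun lam => G.l2Norm (u lam),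
    by linarith, fun lam hlam => ⟨hρ lam hlam, hsol lam hlam, ?_, (add_sub_cancel _ _).symm,
      hmax lam hlam⟩, fun α _ => ?_, ?_⟩
  · exact (hnear lam hlam).memH1_sub_cutoffSoliton hp he₁ hl₁.le hχ (hsol lam hlam).memH1
  · exact MetricGraph.IsNearSoliton.lamNorm_sub_cutoffSoliton_isBigO hp hlam₀ hC.le hl hl₁.le hχ
      hnear (-α)
  · exact MetricGraph.IsNearSoliton.mass_asymptotics hp (by linarith) hC.le hnear
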